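/- Setting. Let $N,d\ge 2$ and let $X=(X_1,\dots,X_d)$ be locally Lipschitz vector fields on $\mathbb R^N$; for a $C^1$ function $u$ let $Xu=(X_1u,\dots,X_du)$. A path $\gamma:[0,T]\to\mathbb R^N$ is $X$-subunit if it is absolutely continuous and, for a.e. $t$, $\dot\gamma(t)=\sum_j\theta_j(t)X_j(\gamma(t))$ with $\sum_j\theta_j(t)^2\le 1$. Assume that any two points $x,y$ of $\mathbb R^N$ are joined by an $X$-subunit path, let $\delta(x,y)$ be the infimum of the $T>0$ for which there is such a path on $[0,T]$, and let $B_r=B_r(x)$ denote the open $\delta$-balls. Assume moreover that * $\delta(x,y)\to0$ if and only if $|x-y|\to 0$; * there is a constant $Q$ with $0<|B_{2r}(x)|\le 2^Q|B_r(x)|$ for all $x\in\mathbb R^N$, $r>0$, where $|\cdot|$ is Lebesgue measure; * there are constants $C_P,\nu>0$ such that, for all balls $B_r=B_r(x)$ and all $u\in C^1(\overline{B_{\nu r}(x)})$ integrable on $B_r$, with $u_r$ the mean of $u$ over $B_r$, $$\frac1{|B_r|}\int_{B_r}|u-u_r|\,dx\le C_P\,r\,\frac1{|B_{\nu r}|}\int_{B_{\nu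 r}}|Xu|\,dx .$$ (Here $u\in C^1(\overline{B_{\nu r}})$ means that $u$ is the restriction of a $C^1$ function on $\mathbb R^N$.) Let $\Omega\subset\mathbb R^N$ be bounded and open and let $1<p<Q$. The space $W^{1,p}_0(\Omega,X)$ consists of the $u\in L^p(\Omega)$ for which there are $\varphi_n\in C^\infty_c(\Omega)$ with $\varphi_n\to u$ in $L^p(\Omega)$ and $X\varphi_n$ convergent in $L^p(\Omega)^d$; the limit of $X\varphi_n$ is $Xu$. Let $a:\Omega\times\mathbb R\times\mathbb R^d\to\mathbb R^d$ be a Carathéodory function such that, for some $\alpha,\beta>0$ and $h\in L^{p'}(\Omega)$, $p'=p/(p-1)$, for a.e. $x\in\Omega$, all $s\in\mathbb R$ and all $\xi\ne\eta$ in $\mathbb R^d$, $$a(x,s,\xi)\cdot\xi\ge\alpha|\xi|^p,\qquad |a(x,s,\xi)|\le\beta\,(h(x)+|s|^{p-1}+|\xi|^{p-1}),\qquad [a(x,s,\xi)-a(x,s,\eta)]\cdot(\xi-\eta)>0 .$$ Theorem. Let $Q/p<m\le\infty$ and $f\in L^m(\Omega)$, and let $u$ be a weak solution of $X^*a(x,u,Xu)=f$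 in $\Omega$, $u=0$ on $\partial\Omega$, that is, $u\in W^{1,p}_0(\Omega,X)$ and $$\int_\Omega a(x,u,Xu)\cdot Xv\,dx=\int_\Omega f\,v\,dx\qquad\text{for all }v\in W^{1,p}_0(\Omega,X).$$ Then $u\in L^\infty(\Omega)$ and $$\|u\|_{L^\infty(\Omega)}\le C\,\|f\|_{L^m(\Omega)}^{1/(p-1)},$$ where the constant $C$ depends only on $Q,p,\Omega,\alpha,m$ and $X$ (with $C_P$ and $\nu$), and not on $a$, $\beta$, $h$, $f$ or $u$. -/

import Mathlib

open MeasureTheory Filter Topology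
open scoped ContDiff ENNReal

noncomputable section

namespace XElliptic

variable {N d : ℕ}

/-- The `X`-gradient `Xu = (X₁u, …, X_d u)` of a `C¹` function `u`, where the vector field `X_j`,
with coefficient vector `X j`, acts as the derivation `X_j u = ∑ₖ c_{jk} ∂ₖ u`. -/
def xGrad (X : Fin d → EuclideanSpace ℝ (Fin N) → EuclideanSpace ℝ (Fin N))
    (u : EuclideanSpace ℝ (Fin N) → ℝ) (x : EuclideanSpace ℝ (Fin N)) :
    EuclideanSpace ℝ (Fin d) :=
  WithLp.toLp 2 fun j => fderiv ℝ u x (X j x)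

/-- `γ : [0, T] → ℝ^N` is an `X`-subunit path: it is absolutely continuous and, for almost every
`t ∈ [0, T]`, `γ'(t) = ∑ⱼ θⱼ X_j(γ(t))` for some `θ = θ(t)` with `∑ⱼ θⱼ² ≤ 1`. -/
def IsSubunit (X : Fin d → EuclideanSpace ℝ (Fin N) → EuclideanSpace ℝ (Fin N))
    (T : ℝ) (γ : ℝ → EuclideanSpace ℝ (Fin N)) : Prop :=
  AbsolutelyContinuousOnInterval γ 0 T ∧
    ∀ᵐ t ∂(volume.restrict (Set.Icc 0 T)), ∃ θ : Fin d → ℝ,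
      ∑ j, θ j ^ 2 ≤ 1 ∧ HasDerivAt γ (∑ j, θ j • X j (γ t)) t

/-- The lengths `T > 0` of the `X`-subunit paths from `x` to `y`. -/
def pathTimes (X : Fin d → EuclideanSpace ℝ (Fin N) → EuclideanSpace ℝ (Fin N))
    (x y : EuclideanSpace ℝ (Fin N)) : Set ℝ :=
  {T | 0 < T ∧ ∃ γ : ℝ → EuclideanSpace ℝ (Fin N), IsSubunit X T γ ∧ γ 0 = x ∧ γ T = y}

/-- Any two points are joined by an `X`-subunit path. -/
def IsXConnected (X : Fin d → EuclideanSpace ℝ (Fin N) → EuclideanSpace ℝ (Fin N)) : Prop :=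
  ∀ x y, (pathTimes X x y).Nonempty

/-- The control (Carnot–Carathéodory) distance of the family `X`. -/
def ccDist (X : Fin d → EuclideanSpace ℝ (Fin N) → EuclideanSpace ℝ (Fin N))
    (x y : EuclideanSpace ℝ (Fin N)) : ℝ :=
  sInf (pathTimes X x y)

/-- The open ball of the control distance. -/
def ccBall (X : Fin d → EuclideanSpace ℝ (Fin N) → EuclideanSpace ℝ (Fin N))
    (x : EuclideanSpace ℝ (Fin N)) (r : ℝ) : Set (EuclideanSpace ℝ (Fin N)) :=
  {y | ccDist X x y < r}

/-- The control distance is topologically equivalent to the Euclidean one: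
`|y - x| → 0` if and only if `δ(x, y) → 0`. -/
def MetricEquivalent (X : Fin d → EuclideanSpace ℝ (Fin N) → EuclideanSpace ℝ (Fin N)) : Prop :=
  ∀ (x : EuclideanSpace ℝ (Fin N)) (y : ℕ → EuclideanSpace ℝ (Fin N)),
    Tendsto (fun n => ‖y n - x‖) atTop (𝓝 0) ↔ Tendsto (fun n => ccDist X x (y n)) atTop (𝓝 0)

/-- Doubling: `0 < |B_{2r}| ≤ 2^Q |B_r|` for all control balls. -/
def IsDoubling (X : Fin d → EuclideanSpace ℝ (Fin N) → EuclideanSpace ℝ (Fin N))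
    (Q : ℝ) : Prop :=
  ∀ (x : EuclideanSpace ℝ (Fin N)) (r : ℝ), 0 < r →
    0 < volume (ccBall X x (2 * r)) ∧
      volume (ccBall X x (2 * r)) ≤ ENNReal.ofReal (2 ^ Q) * volume (ccBall X x r)

/-- The `1,1`-Poincaré inequality `⨍_{B_r} |u - u_r| ≤ C_P r ⨍_{B_{νr}} |Xu|` for all control
balls. A function that is `C¹` in a neighbourhood of the closed set `closure B_{νr}` agrees near
that set with a function that is `C¹` on `ℝ^N`, so only the latter are used. The upper integrals
allow for an infinite right-hand side (if `B_{νr}` is unbounded). -/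
def PoincareIneq (X : Fin d → EuclideanSpace ℝ (Fin N) → EuclideanSpace ℝ (Fin N))
    (CP ν : ℝ) : Prop :=
  ∀ (x₀ : EuclideanSpace ℝ (Fin N)) (r : ℝ), 0 < r →
    ∀ u : EuclideanSpace ℝ (Fin N) → ℝ, ContDiff ℝ 1 u → IntegrableOn u (ccBall X x₀ r) →
      (⨍⁻ x, ‖u x - ⨍ y in ccBall X x₀ r, u y‖ₑ ∂(volume.restrict (ccBall X x₀ r))) ≤
        ENNReal.ofReal (CP * r) *
          ⨍⁻ x, ‖xGrad X u x‖ₑ ∂(volume.restrict (ccBall X x₀ (ν * r)))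

/-- `u ∈ W₀^{1,p}(Ω, X)` with `X`-gradient `Xu = U`: there are `φₙ ∈ C_c^∞(Ω)` such that
`Xφₙ → U` in `L^p(Ω)^d` and `φₙ → u` in `L^p(Ω)`. As the fields are locally Lipschitz, `u`
determines `U` almost everywhere. -/
def IsSobolevZero (X : Fin d → EuclideanSpace ℝ (Fin N) → EuclideanSpace ℝ (Fin N))
    (Ω : Set (EuclideanSpace ℝ (Fin N))) (p : ℝ)
    (u : EuclideanSpace ℝ (Fin N) → ℝ)
    (U : EuclideanSpace ℝ (Fin N) → EuclideanSpace ℝ (Fin d)) : Prop :=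
  MemLp u (ENNReal.ofReal p) (volume.restrict Ω) ∧
  MemLp U (ENNReal.ofReal p) (volume.restrict Ω) ∧
  ∃ φ : ℕ → EuclideanSpace ℝ (Fin N) → ℝ,
    (∀ n, ContDiff ℝ ∞ (φ n) ∧ HasCompactSupport (φ n) ∧ tsupport (φ n) ⊆ Ω) ∧
    Tendsto (fun n => eLpNorm (fun x => φ n x - u x) (ENNReal.ofReal p) (volume.restrict Ω))
      atTop (𝓝 0) ∧
    Tendsto (fun n => eLpNorm (fun x => xGrad X (φ n) x - U x) (ENNReal.ofReal p)
      (volume.restrict Ω)) atTop (𝓝 0)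

/-- The structural conditions on `a(x, s, ξ)`: it is a Carathéodory function on `Ω × ℝ × ℝ^d`,
it is coercive with constant `α`, it has growth of order `p - 1` with constant `β` and
`h ∈ L^{p'}(Ω)`, `p' = p / (p - 1)`, and it is strictly monotone in `ξ`. -/
structure IsLerayLions (Ω : Set (EuclideanSpace ℝ (Fin N))) (p α β : ℝ)
    (h : EuclideanSpace ℝ (Fin N) → ℝ)
    (a : EuclideanSpace ℝ (Fin N) → ℝ → EuclideanSpace ℝ (Fin d) → EuclideanSpace ℝ (Fin d)) :
    Prop where
  measurable : ∀ s ξ, AEStronglyMeasurable (fun x => a x s ξ) (volume.restrict Ω)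
  continuous : ∀ᵐ x ∂(volume.restrict Ω),
    Continuous fun z : ℝ × EuclideanSpace ℝ (Fin d) => a x z.1 z.2
  memLp : MemLp h (ENNReal.ofReal (p / (p - 1))) (volume.restrict Ω)
  coercive : ∀ᵐ x ∂(volume.restrict Ω), ∀ s ξ, α * ‖ξ‖ ^ p ≤ inner ℝ (a x s ξ) ξ
  growth : ∀ᵐ x ∂(volume.restrict Ω), ∀ s ξ,
    ‖a x s ξ‖ ≤ β * (h x + |s| ^ (p - 1) + ‖ξ‖ ^ (p - 1))
  monotone : ∀ᵐ x ∂(volume.restrict Ω), ∀ s ξ η, ξ ≠ η →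
    0 < inner ℝ (a x s ξ - a x s η) (ξ - η)

/-- `u` is a weak solution of `X^* a(x, u, Xu) = f` in `Ω`, `u = 0` on `∂Ω`: `u ∈ W₀^{1,p}(Ω, X)`
and `∫_Ω a(x, u, Xu) · Xv = ∫_Ω f v` for all `v ∈ W₀^{1,p}(Ω, X)`. -/
def IsWeakSolution (X : Fin d → EuclideanSpace ℝ (Fin N) → EuclideanSpace ℝ (Fin N))
    (Ω : Set (EuclideanSpace ℝ (Fin N))) (p : ℝ)
    (a : EuclideanSpace ℝ (Fin N) → ℝ → EuclideanSpace ℝ (Fin d) → EuclideanSpace ℝ (Fin d))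
    (f u : EuclideanSpace ℝ (Fin N) → ℝ) : Prop :=
  ∃ U : EuclideanSpace ℝ (Fin N) → EuclideanSpace ℝ (Fin d),
    IsSobolevZero X Ω p u U ∧
    ∀ (v : EuclideanSpace ℝ (Fin N) → ℝ)
      (V : EuclideanSpace ℝ (Fin N) → EuclideanSpace ℝ (Fin d)),
      IsSobolevZero X Ω p v V →
        ∫ x in Ω, inner ℝ (a x (u x) (U x)) (V x) = ∫ x in Ω, f x * v x

end XElliptic

end

/-! The bound comes from a Sobolev inequality for the geometry of `X`, followed by Stampacchia's
truncation method.

Sobolev. Telescoping the Poincaré inequality along the balls of radius `r_i = R 2⁻ⁱ` bounds `|u(x)|`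
by the mean of `u` over `B_R(x)` plus the sum of the terms `r_i ⨍ |Xu|` over `B_{ν r_i}(x)`
(`enorm_le_average_add_tsum`). Averaging maps `L^p` to `L^q` with norm at most a multiple of
`b^{-(1/p-1/q)}`, where `b` bounds the volumes of the balls from below
(`lintegral_ballAvg_rpow_le`). Doubling gives `b ≥ c 2^{-Qi}`, so the `i`-th term costs a multiple
of `2^{-i(1-Q(1/p-1/q))}`, which is summable for subcritical `q`. The mean over `B_R` is absorbed on
the left because `R` is chosen with `|B_R| ≥ 2|Ω|`. The critical exponent and maximal functions are
not needed.

Truncation. Testing with a smooth truncation `Ψ(u)` that vanishes for `|u| ≤ k` gives `α ‖XΨ(u)‖_p^p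
≤ ∫ |f| |Ψ(u)|`. Sobolev, Hölder and Chebyshev turn this into a decay relation for the measures of
`{|u| > k}` (`IsLerayLions.measure_superlevel_decay`). It is superlinear when `p/q < 1 - 1/m`; a
subcritical `q` with this property exists because `m > Q/p` (`exists_exponent`). Then
`eq_zero_of_decay` makes a superlevel set null at an explicit level. -/

/-! ### The control distance and its topology. -/

/-- Precomposition with a `1`-Lipschitz map that sends disjoint intervals to disjoint intervals
preserves absolute continuity. -/
theorem AbsolutelyContinuousOnInterval.comp_of_disjoint {Y : Type*} [PseudoMetricSpace Y]
    {f : ℝ → Y} {σ : ℝ → ℝ} {a b c d : ℝ} (hf : AbsolutelyContinuousOnInterval f a b)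
    (hσ : ∀ s t, dist (σ s) (σ t) ≤ dist s t)
    (hmaps : ∀ t ∈ Set.uIcc c d, σ t ∈ Set.uIcc a b)
    (hdisj : ∀ s t s' t', Disjoint (Set.uIoc s t) (Set.uIoc s' t') →
      Disjoint (Set.uIoc (σ s) (σ t)) (Set.uIoc (σ s') (σ t'))) :
    AbsolutelyContinuousOnInterval (fun t => f (σ t)) c d := by
  rw [absolutelyContinuousOnInterval_iff] at hf ⊢
  intro ε hε
  obtain ⟨δ, hδ, h⟩ := hf ε hε
  refine ⟨δ, hδ, fun E hE hlen => ?_⟩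
  refine h (E.1, fun i => (σ (E.2 i).1, σ (E.2 i).2)) ⟨fun i hi => ?_, fun i hi j hj hij => ?_⟩ ?_
  · exact ⟨hmaps _ (hE.1 i hi).1, hmaps _ (hE.1 i hi).2⟩
  · exact hdisj _ _ _ _ (hE.2 hi hj hij)
  · exact (Finset.sum_le_sum fun i _ => hσ _ _).trans_lt hlen

theorem Monotone.disjoint_uIoc {σ : ℝ → ℝ} (hσ : Monotone σ) (s t s' t' : ℝ)
    (h : Disjoint (Set.uIoc s t) (Set.uIoc s' t')) :
    Disjoint (Set.uIoc (σ s) (σ t)) (Set.uIoc (σ s') (σ t')) := by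
  simp only [Set.uIoc, Set.Ioc_disjoint_Ioc, ← hσ.map_min, ← hσ.map_max] at h ⊢
  exact hσ h

theorem Antitone.disjoint_uIoc {σ : ℝ → ℝ} (hσ : Antitone σ) (s t s' t' : ℝ)
    (h : Disjoint (Set.uIoc s t) (Set.uIoc s' t')) :
    Disjoint (Set.uIoc (σ s) (σ t)) (Set.uIoc (σ s') (σ t')) := by
  simp only [Set.uIoc, Set.Ioc_disjoint_Ioc, ← hσ.map_min, ← hσ.map_max] at h ⊢
  exact hσ h

namespace XElliptic

variable {N d : ℕ} {X : Fin d → EuclideanSpace ℝ (Fin N) → EuclideanSpace ℝ (Fin N)}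

theorem isSubunit_const (x : EuclideanSpace ℝ (Fin N)) (T : ℝ) : IsSubunit X T fun _ => x := by
  refine ⟨?_, Eventually.of_forall fun t => ⟨0, by simp, by simpa using hasDerivAt_const t x⟩⟩
  exact (LipschitzWith.const x).lipschitzOnWith.absolutelyContinuousOnInterval

theorem IsSubunit.reverse {T : ℝ} (hT : 0 < T) {γ : ℝ → EuclideanSpace ℝ (Fin N)}
    (hγ : IsSubunit X T γ) : IsSubunit X T fun t => γ (T - t) := by
  refine ⟨hγ.1.comp_of_disjoint (fun s t => by
    simp only [Real.dist_eq]; rw [abs_sub_comm s t]; exact le_of_eq (by ring_nf)) (fun t ht => ?_)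
    (Antitone.disjoint_uIoc fun s t hst => by linarith), ?_⟩
  · rw [Set.uIcc_of_le hT.le] at ht ⊢
    exact ⟨by linarith [ht.2], by linarith [ht.1]⟩
  · have h := hγ.2
    rw [ae_restrict_iff' measurableSet_Icc] at h ⊢
    filter_upwards [(Measure.measurePreserving_sub_left volume T).quasiMeasurePreserving.ae h] with t ht htT
    obtain ⟨θ, hθ, hd⟩ := ht ⟨by linarith [htT.2], by linarith [htT.1]⟩
    refine ⟨-θ, by simpa using hθ, ?_⟩
    have := hd.scomp t ((hasDerivAt_id t).const_sub T)
    simpa [Function.comp_def] using this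

/-- Writing the concatenation as a sum of clamped paths avoids a case distinction in absolute
continuity: each clamp is monotone and `1`-Lipschitz, and one path is frozen while the other runs.
The junction time `S` is a null set. -/
theorem IsSubunit.trans {S T : ℝ} (hS : 0 < S) (hT : 0 < T)
    {γ₁ γ₂ : ℝ → EuclideanSpace ℝ (Fin N)} (h₁ : IsSubunit X S γ₁) (h₂ : IsSubunit X T γ₂)
    (h : γ₁ S = γ₂ 0) :
    IsSubunit X (S + T) fun t => γ₁ (min t S) + (γ₂ (max (t - S) 0) - γ₂ 0) := by
  constructor
  · refine AbsolutelyContinuousOnInterval.fun_add ?_ (AbsolutelyContinuousOnInterval.fun_sub ?_ ?_)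
    · refine h₁.1.comp_of_disjoint (fun s t => ?_) (fun t ht => ?_)
        (Monotone.disjoint_uIoc fun s t hst => min_le_min_right _ hst)
      · simpa [Real.dist_eq] using abs_min_sub_min_le_max s S t S
      · rw [Set.uIcc_of_le (by linarith)] at ht ⊢
        exact ⟨le_min ht.1 hS.le, min_le_right _ _⟩
    · refine h₂.1.comp_of_disjoint (σ := fun t => max (t - S) 0) (fun s t => ?_) (fun t ht => ?_)
        (Monotone.disjoint_uIoc fun s t hst => max_le_max_right _ (by linarith))
      · simpa [Real.dist_eq] using abs_max_sub_max_le_max (s - S) 0 (t - S) 0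
      · rw [Set.uIcc_of_le (by linarith)] at ht ⊢
        exact ⟨le_max_right _ _, max_le (by linarith [ht.2]) hT.le⟩
    · exact (isSubunit_const (X := X) (γ₂ 0) _).1
  · have e₁ := h₁.2
    have e₂ := h₂.2
    rw [ae_restrict_iff' measurableSet_Icc] at e₁ e₂ ⊢
    have hne : ∀ᵐ t : ℝ, t ≠ S := by simp [ae_iff]
    filter_upwards [e₁, (measurePreserving_sub_right volume S).quasiMeasurePreserving.ae e₂, hne]
      with t ht₁ ht₂ htS ht
    rcases lt_or_gt_of_ne htS with hlt | hgt
    · obtain ⟨θ, hθ, hd⟩ := ht₁ ⟨ht.1, hlt.le⟩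
      refine ⟨θ, hθ, ?_⟩
      have e : (fun t => γ₁ (min t S) + (γ₂ (max (t - S) 0) - γ₂ 0)) =ᶠ[𝓝 t] γ₁ := by
        filter_upwards [Iio_mem_nhds hlt] with s hs
        rw [min_eq_left (le_of_lt hs), max_eq_right (by linarith [Set.mem_Iio.1 hs])]; simp
      simpa only [e.eq_of_nhds] using hd.congr_of_eventuallyEq e
    · obtain ⟨θ, hθ, hd⟩ := ht₂ ⟨by linarith, by linarith [ht.2]⟩
      refine ⟨θ, hθ, ?_⟩
      have e : (fun t => γ₁ (min t S) + (γ₂ (max (t - S) 0) - γ₂ 0)) =ᶠ[𝓝 t]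
          fun t => γ₂ (t - S) := by
        filter_upwards [Ioi_mem_nhds hgt] with s hs
        rw [min_eq_right (le_of_lt hs), max_eq_left (by linarith [Set.mem_Ioi.1 hs]), h]; simp
      have hd' : HasDerivAt (fun t => γ₂ (t - S)) (∑ j, θ j • X j (γ₂ (t - S))) t :=
        hd.comp_sub_const t S
      simpa only [e.eq_of_nhds] using hd'.congr_of_eventuallyEq e

theorem pathTimes_self {x : EuclideanSpace ℝ (Fin N)} {T : ℝ} (hT : 0 < T) : T ∈ pathTimes X x x :=
  ⟨hT, _, isSubunit_const x T, rfl, rfl⟩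

theorem pathTimes_comm (x y : EuclideanSpace ℝ (Fin N)) : pathTimes X x y = pathTimes X y x := by
  have key : ∀ x y, pathTimes X x y ⊆ pathTimes X y x := by
    rintro x y T ⟨hT, γ, hγ, rfl, rfl⟩
    exact ⟨hT, _, hγ.reverse hT, by simp, by simp⟩
  exact (key x y).antisymm (key y x)

theorem add_mem_pathTimes {x y z : EuclideanSpace ℝ (Fin N)} {S T : ℝ} (hS : S ∈ pathTimes X x y)
    (hT : T ∈ pathTimes X y z) : S + T ∈ pathTimes X x z := by
  obtain ⟨hS, γ₁, h₁, rfl, rfl⟩ := hS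
  obtain ⟨hT, γ₂, h₂, h, rfl⟩ := hT
  refine ⟨by linarith, _, h₁.trans hS hT h₂ h.symm, ?_, ?_⟩
  · simp [hS.le]
  · simp [hT.le, h]

theorem bddBelow_pathTimes (x y : EuclideanSpace ℝ (Fin N)) : BddBelow (pathTimes X x y) :=
  ⟨0, fun _ hT => hT.1.le⟩

theorem ccDist_nonneg (x y : EuclideanSpace ℝ (Fin N)) : 0 ≤ ccDist X x y :=
  Real.sInf_nonneg fun _ hT => hT.1.le

theorem ccDist_self (x : EuclideanSpace ℝ (Fin N)) : ccDist X x x = 0 :=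
  le_antisymm (le_of_forall_pos_le_add fun ε hε => by
    simpa [ccDist] using csInf_le (bddBelow_pathTimes x x) (pathTimes_self (X := X) hε)) (ccDist_nonneg x x)

theorem ccDist_comm (x y : EuclideanSpace ℝ (Fin N)) : ccDist X x y = ccDist X y x := by
  rw [ccDist, pathTimes_comm, ccDist]

theorem ccDist_triangle (hconn : IsXConnected X) (x y z : EuclideanSpace ℝ (Fin N)) :
    ccDist X x z ≤ ccDist X x y + ccDist X y z := by
  refine le_of_forall_pos_le_add fun ε hε => ?_
  obtain ⟨S, hS, hS'⟩ := Real.lt_sInf_add_pos (hconn x y) (half_pos hε)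
  obtain ⟨T, hT, hT'⟩ := Real.lt_sInf_add_pos (hconn y z) (half_pos hε)
  have := csInf_le (bddBelow_pathTimes x z) (add_mem_pathTimes hS hT)
  simp only [ccDist] at *
  linarith

theorem tendsto_ccDist_self (hmetric : MetricEquivalent X) (x : EuclideanSpace ℝ (Fin N)) :
    Tendsto (ccDist X x) (𝓝 x) (𝓝 0) :=
  tendsto_of_seq_tendsto fun y hy =>
    (hmetric x y).1 (by simpa using (tendsto_iff_norm_sub_tendsto_zero.1 hy))

/-- By the triangle inequality the distance changes by at most `δ(x, x') + δ(y, y')`. Joint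
continuity is what makes ball averages measurable in the centre. -/
theorem continuous_ccDist (hconn : IsXConnected X) (hmetric : MetricEquivalent X) :
    Continuous fun z : EuclideanSpace ℝ (Fin N) × EuclideanSpace ℝ (Fin N) =>
      ccDist X z.1 z.2 := by
  rw [continuous_iff_continuousAt]
  rintro ⟨x, y⟩
  rw [ContinuousAt, tendsto_iff_dist_tendsto_zero]
  have h : Tendsto (fun z : EuclideanSpace ℝ (Fin N) × EuclideanSpace ℝ (Fin N) =>
      ccDist X x z.1 + ccDist X y z.2) (𝓝 (x, y)) (𝓝 (0 + 0)) := by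
    rw [nhds_prod_eq]
    exact ((tendsto_ccDist_self hmetric x).comp tendsto_fst).add
      ((tendsto_ccDist_self hmetric y).comp tendsto_snd)
  rw [add_zero] at h
  refine squeeze_zero (fun _ => dist_nonneg) (fun z => ?_) h
  have := ccDist_triangle hconn x z.1 y
  have := ccDist_triangle hconn z.1 z.2 y
  have := ccDist_triangle hconn z.1 x z.2
  have := ccDist_triangle hconn x y z.2
  have := ccDist_comm (X := X) x z.1
  have := ccDist_comm (X := X) y z.2
  rw [Real.dist_eq, abs_le]
  constructor <;> dsimp only at * <;> linarith

theorem isOpen_ccBall (hconn : IsXConnected X) (hmetric : MetricEquivalent X)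
    (x : EuclideanSpace ℝ (Fin N)) (r : ℝ) : IsOpen (ccBall X x r) :=
  isOpen_lt ((continuous_ccDist hconn hmetric).comp (Continuous.prodMk_right x)) continuous_const

theorem ccBall_mono (x : EuclideanSpace ℝ (Fin N)) {r s : ℝ} (h : r ≤ s) :
    ccBall X x r ⊆ ccBall X x s := fun _ hy => lt_of_lt_of_le hy h

theorem ccBall_subset_ccBall (hconn : IsXConnected X) {x y : EuclideanSpace ℝ (Fin N)} {r s : ℝ}
    (h : ccDist X y x + r ≤ s) : ccBall X x r ⊆ ccBall X y s := fun z hz => by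
  have := ccDist_triangle hconn y x z
  simp only [ccBall, Set.mem_ofPred_eq] at *
  linarith

theorem exists_ccBall_subset (hmetric : MetricEquivalent X) (x : EuclideanSpace ℝ (Fin N))
    {ε : ℝ} (hε : 0 < ε) : ∃ r : ℝ, 0 < r ∧ ccBall X x r ⊆ Metric.ball x ε := by
  by_contra! H
  have H' : ∀ n : ℕ, ∃ y, ccDist X x y < 1 / ((n : ℝ) + 1) ∧ ε ≤ ‖y - x‖ := fun n => by
    obtain ⟨y, hy, hy'⟩ := Set.not_subset.1 (H (1 / ((n : ℝ) + 1)) (by positivity))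
    exact ⟨y, hy, by simpa [dist_eq_norm] using hy'⟩
  choose y hy hy' using H'
  have : Tendsto (fun n => ccDist X x (y n)) atTop (𝓝 0) :=
    squeeze_zero (fun n => ccDist_nonneg _ _) (fun n => (hy n).le)
      tendsto_one_div_add_atTop_nhds_zero_nat
  exact hε.not_ge (ge_of_tendsto' ((hmetric x y).2 this) hy')

/-! ### Volumes of control balls. -/

section Doubling

variable {Q : ℝ}

theorem volume_ccBall_pos (hdoubling : IsDoubling X Q) (x : EuclideanSpace ℝ (Fin N)) {r : ℝ}
    (hr : 0 < r) : 0 < volume (ccBall X x r) := by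
  simpa [mul_div_cancel₀] using (hdoubling x (r / 2) (half_pos hr)).1

theorem volume_ccBall_le_pow_mul (hdoubling : IsDoubling X Q) (x : EuclideanSpace ℝ (Fin N))
    {r : ℝ} (hr : 0 < r) (n : ℕ) :
    volume (ccBall X x r) ≤ ENNReal.ofReal (2 ^ Q) ^ n * volume (ccBall X x (r * 2⁻¹ ^ n)) := by
  induction n with
  | zero => simp
  | succ n ih =>
    have h := (hdoubling x (r * 2⁻¹ ^ (n + 1)) (by positivity)).2
    rw [show 2 * (r * 2⁻¹ ^ (n + 1)) = r * 2⁻¹ ^ n by rw [pow_succ]; ring] at h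
    calc _ ≤ _ := ih
      _ ≤ ENNReal.ofReal (2 ^ Q) ^ n * (ENNReal.ofReal (2 ^ Q) *
          volume (ccBall X x (r * 2⁻¹ ^ (n + 1)))) := by gcongr
      _ = _ := by rw [pow_succ]; ring

/-- Large control balls are not known to be bounded; finiteness is carried by doubling from a small
ball inside a Euclidean one. -/
theorem volume_ccBall_lt_top (hmetric : MetricEquivalent X) (hdoubling : IsDoubling X Q)
    (x : EuclideanSpace ℝ (Fin N)) (r : ℝ) : volume (ccBall X x r) < ⊤ := by
  obtain ⟨s, hs, hsub⟩ := exists_ccBall_subset hmetric x one_pos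
  have hr : 0 < max r 1 := by positivity
  obtain ⟨n, hn⟩ := exists_pow_lt_of_lt_one (div_pos hs hr) (show (2⁻¹ : ℝ) < 1 by norm_num)
  have hlt : max r 1 * 2⁻¹ ^ n ≤ s := by rw [lt_div_iff₀ hr] at hn; linarith
  refine (measure_mono (ccBall_mono x (le_max_left r 1))).trans_lt ?_
  refine (volume_ccBall_le_pow_mul hdoubling x hr n).trans_lt ?_
  refine ENNReal.mul_lt_top (ENNReal.pow_lt_top ENNReal.ofReal_lt_top) ?_
  exact (measure_mono ((ccBall_mono x hlt).trans hsub)).trans_lt measure_ball_lt_top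

theorem iUnion_ccBall (x : EuclideanSpace ℝ (Fin N)) : ⋃ n : ℕ, ccBall X x n = Set.univ :=
  Set.eq_univ_of_forall fun y => Set.mem_iUnion.2 (exists_nat_gt (ccDist X x y))

theorem tendsto_volume_ccBall (hN : 2 ≤ N) (x : EuclideanSpace ℝ (Fin N)) :
    Tendsto (fun n : ℕ => volume (ccBall X x n)) atTop (𝓝 ⊤) := by
  have : Nonempty (Fin N) := ⟨⟨0, by omega⟩⟩
  have h := tendsto_measure_iUnion_atTop (μ := volume) (s := fun n : ℕ => ccBall X x n)
    fun m n hmn => ccBall_mono x (by exact_mod_cast hmn)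
  rwa [iUnion_ccBall, measure_univ_of_isAddLeftInvariant] at h

/-- On a bounded set the control balls of a suitable radius `R` are as large as wanted, and the
volumes of the control balls with the radii `ν R 2⁻ⁱ` decay at most like `2^(-Q i)`. -/
theorem exists_radius (hN : 2 ≤ N) (hconn : IsXConnected X) (hmetric : MetricEquivalent X)
    (hdoubling : IsDoubling X Q) {ν : ℝ} (hν : 0 < ν) {Ω : Set (EuclideanSpace ℝ (Fin N))}
    (hΩb : Bornology.IsBounded Ω) {M : ℝ≥0∞} (hM : M ≠ ⊤) :
    ∃ R : ℝ, 0 < R ∧ (∀ x ∈ Ω, M ≤ volume (ccBall X x R)) ∧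
      ∃ c : ℝ≥0∞, c ≠ 0 ∧ ∀ x ∈ Ω, ∀ i : ℕ,
        c ≤ ENNReal.ofReal (2 ^ Q) ^ i * volume (ccBall X x (ν * (R * 2⁻¹ ^ i))) := by
  obtain ⟨n, hn⟩ := ((tendsto_volume_ccBall (X := X) hN 0).eventually
    (lt_mem_nhds hM.lt_top)).exists
  obtain ⟨D, hD⟩ := (hΩb.isCompact_closure).bddAbove_image (f := ccDist X 0)
    ((continuous_ccDist hconn hmetric).comp (Continuous.prodMk_right 0)).continuousOn
  have hD' : ∀ x ∈ Ω, ccDist X 0 x ≤ D := fun x hx =>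
    hD (Set.mem_image_of_mem _ (subset_closure hx))
  -- With this `R`, every ball `B_R(x)`, `x ∈ Ω`, contains both `B_n(0)`, of volume above `M`, and
  -- the reference ball `B_1(0)`.
  set R : ℝ := |D| + n + 1 with hR
  have hR0 : 0 < R := by positivity
  have hsub : ∀ x ∈ Ω, ∀ s ≤ (n : ℝ) + 1, ccBall X 0 s ⊆ ccBall X x R := fun x hx s hs =>
    ccBall_subset_ccBall hconn (by
      rw [ccDist_comm]; linarith [hD' x hx, le_abs_self D])
  -- The factor `ν` is paid for by `k` further halvings, since `2⁻ᵏ < ν`.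
  obtain ⟨k, hk⟩ := exists_pow_lt_of_lt_one hν (show (2⁻¹ : ℝ) < 1 by norm_num)
  have hA0 : ENNReal.ofReal (2 ^ Q) ≠ 0 := by simp; positivity
  refine ⟨R, hR0, fun x hx => hn.le.trans (measure_mono (hsub x hx n (by linarith))),
    volume (ccBall X (0 : EuclideanSpace ℝ (Fin N)) 1) / ENNReal.ofReal (2 ^ Q) ^ k, ?_, ?_⟩
  · exact (ENNReal.div_pos (volume_ccBall_pos hdoubling 0 one_pos).ne'
      (ENNReal.pow_ne_top ENNReal.ofReal_ne_top)).ne'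
  · intro x hx i
    rw [ENNReal.div_le_iff (pow_ne_zero _ hA0) (ENNReal.pow_ne_top ENNReal.ofReal_ne_top)]
    calc volume (ccBall X (0 : EuclideanSpace ℝ (Fin N)) 1) ≤ volume (ccBall X x R) :=
          measure_mono (hsub x hx 1 (by linarith [n.cast_nonneg (α := ℝ)]))
      _ ≤ ENNReal.ofReal (2 ^ Q) ^ (k + i) * volume (ccBall X x (R * 2⁻¹ ^ (k + i))) :=
          volume_ccBall_le_pow_mul hdoubling x hR0 _
      _ ≤ ENNReal.ofReal (2 ^ Q) ^ (k + i) * volume (ccBall X x (ν * (R * 2⁻¹ ^ i))) := by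
          gcongr
          refine ccBall_mono x ?_
          rw [pow_add, show R * (2⁻¹ ^ k * 2⁻¹ ^ i) = 2⁻¹ ^ k * (R * 2⁻¹ ^ i) by ring]
          gcongr
      _ = _ := by rw [pow_add]; ring

end Doubling

end XElliptic

/-! ### Inequalities for averages and for sums of functions. -/

section General

variable {α : Type*} [MeasurableSpace α] {μ : Measure α}

/-- This is Jensen's inequality, in the form that `L^p` norms increase with `p` for the normalised
measure. -/
theorem laverage_rpow_le {p : ℝ} (hp : 1 ≤ p) {g : α → ℝ≥0∞} (hg : AEMeasurable g μ)
    (h0 : μ Set.univ ≠ 0) (htop : μ Set.univ ≠ ⊤) :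
    (⨍⁻ x, g x ∂μ) ^ p ≤ ⨍⁻ x, g x ^ p ∂μ := by
  have : IsProbabilityMeasure ((μ Set.univ)⁻¹ • μ) :=
    ⟨by simp [ENNReal.inv_mul_cancel h0 htop]⟩
  have h := eLpNorm'_le_eLpNorm'_of_exponent_le one_pos hp ((μ Set.univ)⁻¹ • μ)
    (hg.smul_measure _).aestronglyMeasurable
  simp only [eLpNorm', enorm_eq_self, ENNReal.rpow_one, div_one, one_div] at h
  rw [laverage_eq', laverage_eq']
  exact (ENNReal.le_rpow_inv_iff (by linarith)).1 h

theorem enorm_average_sub_le {u : α → ℝ} (hu : Integrable u μ) (h0 : μ Set.univ ≠ 0)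
    (htop : μ Set.univ ≠ ⊤) (c : ℝ) :
    ‖(⨍ y, u y ∂μ) - c‖ₑ ≤ ⨍⁻ y, ‖u y - c‖ₑ ∂μ := by
  have : IsFiniteMeasure μ := ⟨htop.lt_top⟩
  have : NeZero μ := ⟨fun h => h0 (by simp [h])⟩
  have hc : (⨍ y, u y ∂μ) - c = ⨍ y, (u y - c) ∂μ := by
    conv_lhs => rw [← average_const μ c]
    rw [average_eq, average_eq, average_eq, integral_sub hu (integrable_const c), smul_sub]
  rw [hc, average_eq', laverage_eq']
  exact enorm_integral_le_lintegral_enorm _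

/-- Minkowski's inequality for infinite sums. -/
theorem lintegral_tsum_rpow_le {q : ℝ} (hq : 1 ≤ q) {F : ℕ → α → ℝ≥0∞}
    (hF : ∀ i, Measurable (F i)) :
    (∫⁻ x, (∑' i, F i x) ^ q ∂μ) ^ (1 / q) ≤ ∑' i, (∫⁻ x, F i x ^ q ∂μ) ^ (1 / q) := by
  have hq0 : 0 < q := by linarith
  have hfin : ∀ n : ℕ, ∫⁻ x, (∑ i ∈ Finset.range n, F i x) ^ q ∂μ ≤
      (∑' i, (∫⁻ x, F i x ^ q ∂μ) ^ (1 / q)) ^ q := fun n => by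
    have h := eLpNorm_sum_le (μ := μ) (p := ENNReal.ofReal q) (s := Finset.range n) (f := F)
      (fun i _ => (hF i).aestronglyMeasurable) (by simpa using hq)
    simp only [eLpNorm_eq_lintegral_rpow_enorm_toReal (ENNReal.ofReal_pos.2 hq0).ne'
      ENNReal.ofReal_ne_top, ENNReal.toReal_ofReal hq0.le, enorm_eq_self, Finset.sum_apply] at h
    have h' := h.trans (ENNReal.sum_le_tsum (Finset.range n))
    rw [one_div] at h' ⊢
    exact (ENNReal.rpow_inv_le_iff hq0).1 h'
  have hlim : ∫⁻ x, (∑' i, F i x) ^ q ∂μ =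
      ⨆ n : ℕ, ∫⁻ x, (∑ i ∈ Finset.range n, F i x) ^ q ∂μ := by
    rw [← lintegral_iSup]
    · refine lintegral_congr fun x => ?_
      rw [ENNReal.tsum_eq_iSup_nat]
      exact (ENNReal.orderIsoRpow q hq0).map_iSup _
    · exact fun n => (Finset.measurable_sum _ fun i _ => hF i).pow_const _
    · intro m n hmn x
      dsimp only
      gcongr
  rw [hlim]
  have := ENNReal.rpow_le_rpow (iSup_le hfin) (one_div_nonneg.2 hq0.le)
  rwa [← ENNReal.rpow_mul, mul_one_div_cancel hq0.ne', ENNReal.rpow_one] at this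

end General

/-! ### Averaging operators and the Sobolev inequality for test functions. -/

namespace XElliptic

variable {N d : ℕ} {X : Fin d → EuclideanSpace ℝ (Fin N) → EuclideanSpace ℝ (Fin N)} {Q : ℝ}

/-- The averages of `g` over the control balls of radius `s`. -/
noncomputable def ballAvg (X : Fin d → EuclideanSpace ℝ (Fin N) → EuclideanSpace ℝ (Fin N)) (s : ℝ)
    (g : EuclideanSpace ℝ (Fin N) → ℝ≥0∞) (x : EuclideanSpace ℝ (Fin N)) : ℝ≥0∞ :=
  ⨍⁻ y, g y ∂(volume.restrict (ccBall X x s))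

theorem measurable_volume_ccBall (hconn : IsXConnected X) (hmetric : MetricEquivalent X) (s : ℝ) :
    Measurable fun x => volume (ccBall X x s) :=
  measurable_measure_prodMk_left
    (isOpen_lt (continuous_ccDist hconn hmetric) continuous_const).measurableSet

theorem measurable_ballAvg (hconn : IsXConnected X) (hmetric : MetricEquivalent X) (s : ℝ)
    {g : EuclideanSpace ℝ (Fin N) → ℝ≥0∞} (hg : Measurable g) : Measurable (ballAvg X s g) := by
  have hS : MeasurableSet {z : EuclideanSpace ℝ (Fin N) × EuclideanSpace ℝ (Fin N) |
    ccDist X z.1 z.2 < s} := (isOpen_lt (continuous_ccDist hconn hmetric) continuous_const).measurableSet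
  have h : ballAvg X s g = fun x => (∫⁻ y, Set.indicator {z : EuclideanSpace ℝ (Fin N) ×
      EuclideanSpace ℝ (Fin N) | ccDist X z.1 z.2 < s} (fun z => g z.2) (x, y)) /
      volume (ccBall X x s) := by
    funext x
    rw [ballAvg, setLAverage_eq, ← lintegral_indicator (isOpen_ccBall hconn hmetric x s).measurableSet]
    rfl
  rw [h]
  exact (((hg.comp measurable_snd).indicator hS).lintegral_prod_right').div
    (measurable_volume_ccBall hconn hmetric s)

/-- Averaging over control balls of a fixed radius is bounded on `L¹`. -/
theorem lintegral_ballAvg_le (hconn : IsXConnected X) (hmetric : MetricEquivalent X)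
    (hdoubling : IsDoubling X Q) {s : ℝ} (hs : 0 < s)
    {g : EuclideanSpace ℝ (Fin N) → ℝ≥0∞} (hg : Measurable g) :
    ∫⁻ x, ballAvg X s g x ≤ ENNReal.ofReal (2 ^ Q) * ∫⁻ y, g y := by
  set A := ENNReal.ofReal (2 ^ Q) with hA
  have hA0 : A ≠ 0 := by simp [hA]; positivity
  have hAt : A ≠ ⊤ := ENNReal.ofReal_ne_top
  set S := {z : EuclideanSpace ℝ (Fin N) × EuclideanSpace ℝ (Fin N) | ccDist X z.1 z.2 < s} with hSdef
  have hS : MeasurableSet S :=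
    (isOpen_lt (continuous_ccDist hconn hmetric) continuous_const).measurableSet
  have hmeas : Measurable (S.indicator fun z => A * (g z.2 / volume (ccBall X z.2 s))) :=
    (((hg.comp measurable_snd).div
      ((measurable_volume_ccBall hconn hmetric s).comp measurable_snd)).const_mul A).indicator hS
  calc ∫⁻ x, ballAvg X s g x
      ≤ ∫⁻ x, ∫⁻ y, S.indicator (fun z => A * (g z.2 / volume (ccBall X z.2 s))) (x, y) := by
        refine lintegral_mono fun x => ?_
        have hx0 := (volume_ccBall_pos hdoubling x hs).ne'
        have hxt := (volume_ccBall_lt_top hmetric hdoubling x s).ne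
        rw [ballAvg, setLAverage_eq, ENNReal.div_eq_inv_mul,
          ← lintegral_indicator (isOpen_ccBall hconn hmetric x s).measurableSet,
          ← lintegral_const_mul' _ _ (ENNReal.inv_ne_top.2 hx0)]
        refine lintegral_mono fun y => ?_
        by_cases hy : ccDist X x y < s
        · have h1 : y ∈ ccBall X x s := hy
          have h2 : (x, y) ∈ S := hy
          -- For `y ∈ B_s(x)` one has `B_s(y) ⊆ B_{2s}(x)`. The denominator can thus be made to
          -- depend on `y` alone, after which Tonelli integrates out `x`.
          have hvol : volume (ccBall X y s) ≤ A * volume (ccBall X x s) :=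
            (measure_mono (ccBall_subset_ccBall hconn (by linarith))).trans (hdoubling x s hs).2
          rw [Set.indicator_of_mem h1, Set.indicator_of_mem h2, ← mul_div_assoc, mul_comm A,
            mul_div_assoc, mul_comm]
          gcongr
          rw [ENNReal.inv_le_iff_inv_le, ENNReal.inv_div (Or.inl (volume_ccBall_lt_top hmetric hdoubling y s).ne) (Or.inr hA0)]
          exact ENNReal.div_le_of_le_mul' hvol
        · have h1 : y ∉ ccBall X x s := hy
          rw [Set.indicator_of_notMem h1]
          simp
    _ = ∫⁻ y, ∫⁻ x, S.indicator (fun z => A * (g z.2 / volume (ccBall X z.2 s))) (x, y) :=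
        lintegral_lintegral_swap hmeas.aemeasurable
    _ ≤ ∫⁻ y, A * g y := by
        refine lintegral_mono fun y => ?_
        have : ∀ x, S.indicator (fun z => A * (g z.2 / volume (ccBall X z.2 s))) (x, y) =
            (ccBall X y s).indicator (fun _ => A * (g y / volume (ccBall X y s))) x := fun x => by
          simp only [Set.indicator, hSdef, ccBall, Set.mem_ofPred_eq, ccDist_comm x y]
          congr
        simp only [this]
        rw [lintegral_indicator_const (isOpen_ccBall hconn hmetric y s).measurableSet, mul_assoc,
          ENNReal.div_mul_cancel (volume_ccBall_pos hdoubling y hs).ne'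
          (volume_ccBall_lt_top hmetric hdoubling y s).ne]
    _ = A * ∫⁻ y, g y := lintegral_const_mul' _ _ hAt

theorem ballAvg_rpow_le (hmetric : MetricEquivalent X)
    (hdoubling : IsDoubling X Q) {s p : ℝ} (hs : 0 < s) (hp : 1 ≤ p)
    {g : EuclideanSpace ℝ (Fin N) → ℝ≥0∞} (hg : Measurable g) (x : EuclideanSpace ℝ (Fin N)) :
    ballAvg X s g x ^ p ≤ ballAvg X s (fun y => g y ^ p) x :=
  laverage_rpow_le hp hg.aemeasurable
    (by simpa using (volume_ccBall_pos hdoubling x hs).ne')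
    (by simpa using (volume_ccBall_lt_top hmetric hdoubling x s).ne)

/-- Averaging over control balls of volume at least `b` improves integrability from `L^p` to
`L^q`. -/
theorem lintegral_ballAvg_rpow_le (hconn : IsXConnected X) (hmetric : MetricEquivalent X)
    (hdoubling : IsDoubling X Q) {s p q : ℝ} (hs : 0 < s) (hp : 1 ≤ p) (hpq : p ≤ q)
    {Ω : Set (EuclideanSpace ℝ (Fin N))} (hΩ : MeasurableSet Ω) {b : ℝ≥0∞}
    (hb : ∀ x ∈ Ω, b ≤ volume (ccBall X x s))
    {g : EuclideanSpace ℝ (Fin N) → ℝ≥0∞} (hg : Measurable g) :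
    (∫⁻ x in Ω, ballAvg X s g x ^ q) ^ (1 / q) ≤
      ENNReal.ofReal (2 ^ Q) ^ (1 / q) * b⁻¹ ^ (1 / p - 1 / q) * (∫⁻ y, g y ^ p) ^ (1 / p) := by
  have hp0 : 0 < p := by linarith
  have hq0 : 0 < q := by linarith
  set I := ∫⁻ y, g y ^ p with hI
  set A := ENNReal.ofReal (2 ^ Q) with hA
  have hqp : 0 ≤ q / p - 1 := by rw [sub_nonneg, le_div_iff₀ hp0]; linarith
  -- Of the `q` powers, `q - p` are estimated by the uniform bound on the average of `g ^ p`; the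
  -- other `p` are kept for the `L¹` bound.
  have hpt : ∀ x ∈ Ω, ballAvg X s g x ^ q ≤
      (b⁻¹ * I) ^ (q / p - 1) * ballAvg X s (fun y => g y ^ p) x := by
    intro x hx
    have h1 := ballAvg_rpow_le hmetric hdoubling hs hp hg x
    have h2 : ballAvg X s (fun y => g y ^ p) x ≤ b⁻¹ * I := by
      rw [ballAvg, setLAverage_eq, ENNReal.div_eq_inv_mul]
      gcongr
      · exact hb x hx
      · exact setLIntegral_le_lintegral _ _
    calc ballAvg X s g x ^ q = (ballAvg X s g x ^ p) ^ (q / p - 1) * ballAvg X s g x ^ p := by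
          rw [← ENNReal.rpow_mul, ← ENNReal.rpow_add_of_nonneg _ _ (by positivity) hp0.le]
          congr 1; field_simp; ring
      _ ≤ _ := by gcongr; exact h1.trans h2
  have hint : ∫⁻ x in Ω, ballAvg X s g x ^ q ≤ (b⁻¹ * I) ^ (q / p - 1) * (A * I) := by
    calc ∫⁻ x in Ω, ballAvg X s g x ^ q
        ≤ ∫⁻ x in Ω, (b⁻¹ * I) ^ (q / p - 1) * ballAvg X s (fun y => g y ^ p) x :=
          setLIntegral_mono' hΩ hpt
      _ ≤ ∫⁻ x, (b⁻¹ * I) ^ (q / p - 1) * ballAvg X s (fun y => g y ^ p) x :=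
          lintegral_mono' Measure.restrict_le_self le_rfl
      _ = (b⁻¹ * I) ^ (q / p - 1) * ∫⁻ x, ballAvg X s (fun y => g y ^ p) x :=
          lintegral_const_mul _ (measurable_ballAvg hconn hmetric s (hg.pow_const p))
      _ ≤ _ := by gcongr; exact lintegral_ballAvg_le hconn hmetric hdoubling hs (hg.pow_const p)
  calc _ ≤ ((b⁻¹ * I) ^ (q / p - 1) * (A * I)) ^ (1 / q) := by gcongr
    _ = A ^ (1 / q) * b⁻¹ ^ (1 / p - 1 / q) * (I ^ (1 / p - 1 / q) * I ^ (1 / q)) := by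
      rw [ENNReal.mul_rpow_of_nonneg _ _ (by positivity), ← ENNReal.rpow_mul,
        show (q / p - 1) * (1 / q) = 1 / p - 1 / q by field_simp,
        ENNReal.mul_rpow_of_nonneg _ _ (sub_nonneg.2 (one_div_le_one_div_of_le hp0 hpq)),
        ENNReal.mul_rpow_of_nonneg _ _ (by positivity)]
      ring
    _ = _ := by
      rw [← ENNReal.rpow_add_of_nonneg _ _ (sub_nonneg.2 (one_div_le_one_div_of_le hp0 hpq))
        (by positivity), sub_add_cancel]

/-- This identifies the limit of the telescoping sum at every point: small control balls lie in
Euclidean neighbourhoods on which `u` is nearly constant. -/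
theorem tendsto_average_ccBall (hconn : IsXConnected X) (hmetric : MetricEquivalent X)
    (hdoubling : IsDoubling X Q) {u : EuclideanSpace ℝ (Fin N) → ℝ} (hu : Continuous u)
    (hui : Integrable u) (x : EuclideanSpace ℝ (Fin N)) {r : ℕ → ℝ} (hr : ∀ i, 0 < r i)
    (hr0 : Tendsto r atTop (𝓝 0)) :
    Tendsto (fun i => ⨍ y in ccBall X x (r i), u y) atTop (𝓝 (u x)) := by
  rw [EMetric.tendsto_nhds]
  intro ε hε
  obtain ⟨ε', hε', hlt⟩ := exists_between hε
  obtain ⟨δ, hδ, hball⟩ := Metric.nhds_basis_ball.mem_iff.1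
    (hu.continuousAt.preimage_mem_nhds (Metric.closedEBall_mem_nhds (u x) hε'))
  obtain ⟨ρ, hρ, hsub⟩ := exists_ccBall_subset hmetric x hδ
  filter_upwards [hr0.eventually (gt_mem_nhds hρ)] with i hi
  refine lt_of_le_of_lt ?_ hlt
  rw [edist_eq_enorm_sub]
  have h0 := (volume_ccBall_pos hdoubling x (hr i)).ne'
  have ht := (volume_ccBall_lt_top hmetric hdoubling x (r i)).ne
  refine (enorm_average_sub_le hui.restrict (by simpa using h0) (by simpa using ht) (u x)).trans ?_
  rw [setLAverage_eq]
  refine ENNReal.div_le_of_le_mul ?_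
  refine (setLIntegral_mono' (g := fun _ => ε') (isOpen_ccBall hconn hmetric x _).measurableSet
    fun y hy => ?_).trans (by simp)
  have := hball (hsub (ccBall_mono x hi.le hy))
  simpa [edist_eq_enorm_sub] using this

/-- The representation of a function by averages of its gradient, obtained by telescoping the
Poincaré inequality along a sequence of shrinking balls. -/
theorem enorm_le_average_add_tsum (hconn : IsXConnected X) (hmetric : MetricEquivalent X)
    (hdoubling : IsDoubling X Q) {CP ν : ℝ} (hpoincare : PoincareIneq X CP ν)
    {u : EuclideanSpace ℝ (Fin N) → ℝ} (hu : ContDiff ℝ 1 u) (hui : Integrable u)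
    (x : EuclideanSpace ℝ (Fin N)) {R : ℝ} (hR : 0 < R) :
    ‖u x‖ₑ ≤ ‖⨍ y in ccBall X x R, u y‖ₑ +
      ∑' i : ℕ, ENNReal.ofReal (2 ^ Q) * ENNReal.ofReal (CP * (R * 2⁻¹ ^ i)) *
        ballAvg X (ν * (R * 2⁻¹ ^ i)) (fun y => ‖xGrad X u y‖ₑ) x := by
  set a : ℕ → ℝ := fun i => ⨍ y in ccBall X x (R * 2⁻¹ ^ i), u y with ha
  have hr : ∀ i : ℕ, 0 < R * 2⁻¹ ^ i := fun i => by positivity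
  have hr0 : Tendsto (fun i : ℕ => R * (2⁻¹ : ℝ) ^ i) atTop (𝓝 0) := by
    simpa using (tendsto_pow_atTop_nhds_zero_of_lt_one (by norm_num : (0 : ℝ) ≤ 2⁻¹)
      (by norm_num)).const_mul R
  have hlim : Tendsto a atTop (𝓝 (u x)) :=
    tendsto_average_ccBall hconn hmetric hdoubling hu.continuous hui x hr hr0
  have hstep : ∀ i, edist (a i) (a (i + 1)) ≤
      ENNReal.ofReal (2 ^ Q) * ENNReal.ofReal (CP * (R * 2⁻¹ ^ i)) *
        ballAvg X (ν * (R * 2⁻¹ ^ i)) (fun y => ‖xGrad X u y‖ₑ) x := by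
    intro i
    have h0 := (volume_ccBall_pos hdoubling x (hr i)).ne'
    have ht := (volume_ccBall_lt_top hmetric hdoubling x (R * 2⁻¹ ^ i)).ne
    have h0' := (volume_ccBall_pos hdoubling x (hr (i + 1))).ne'
    have ht' := (volume_ccBall_lt_top hmetric hdoubling x (R * 2⁻¹ ^ (i + 1))).ne
    have hhalf : 2 * (R * 2⁻¹ ^ (i + 1)) = R * 2⁻¹ ^ i := by rw [pow_succ]; ring
    have hd := (hdoubling x (R * 2⁻¹ ^ (i + 1)) (hr _)).2
    rw [hhalf] at hd
    rw [edist_comm, edist_eq_enorm_sub, mul_assoc]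
    -- The difference of consecutive means is at most the average of `|u - a i|` over the smaller
    -- ball, hence at most `2^Q` times that over the larger one, to which Poincaré applies.
    refine (enorm_average_sub_le hui.restrict (by simpa using h0') (by simpa using ht')
      (a i)).trans ?_
    refine le_trans ?_ (mul_le_mul_right (hpoincare x _ (hr i) u hu hui.integrableOn) _)
    rw [setLAverage_eq, setLAverage_eq]
    refine ENNReal.div_le_of_le_mul ?_
    calc ∫⁻ y in ccBall X x (R * 2⁻¹ ^ (i + 1)), ‖u y - a i‖ₑ
        ≤ ∫⁻ y in ccBall X x (R * 2⁻¹ ^ i), ‖u y - a i‖ₑ :=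
          lintegral_mono_set (ccBall_mono x (by linarith [hr (i + 1)]))
      _ = (∫⁻ y in ccBall X x (R * 2⁻¹ ^ i), ‖u y - a i‖ₑ) / volume (ccBall X x (R * 2⁻¹ ^ i)) *
          volume (ccBall X x (R * 2⁻¹ ^ i)) := (ENNReal.div_mul_cancel h0 ht).symm
      _ ≤ (∫⁻ y in ccBall X x (R * 2⁻¹ ^ i), ‖u y - a i‖ₑ) / volume (ccBall X x (R * 2⁻¹ ^ i)) *
          (ENNReal.ofReal (2 ^ Q) * volume (ccBall X x (R * 2⁻¹ ^ (i + 1)))) := by gcongr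
      _ = _ := by ring
  have h := edist_le_tsum_of_edist_le_of_tendsto₀ _ hstep hlim
  have ha0 : a 0 = ⨍ y in ccBall X x R, u y := by simp [ha]
  rw [edist_comm, edist_eq_enorm_sub, ha0] at h
  calc ‖u x‖ₑ = ‖(⨍ y in ccBall X x R, u y) + (u x - ⨍ y in ccBall X x R, u y)‖ₑ := by
        congr 1; ring
    _ ≤ _ := (enorm_add_le _ _).trans (by gcongr)

theorem continuous_xGrad (hX : ∀ j, LocallyLipschitz (X j)) {u : EuclideanSpace ℝ (Fin N) → ℝ}
    (hu : ContDiff ℝ 1 u) : Continuous (xGrad X u) := by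
  refine (PiLp.continuous_toLp 2 _).comp (continuous_pi fun j => ?_)
  exact (hu.continuous_fderiv one_ne_zero).clm_apply (hX j).continuous

theorem support_xGrad_subset (u : EuclideanSpace ℝ (Fin N) → ℝ) :
    Function.support (xGrad X u) ⊆ tsupport u := by
  refine fun x hx => support_fderiv_subset ℝ fun h => hx ?_
  ext j
  simp [xGrad, h]

/-- The Sobolev inequality for test functions, for exponents `q` below the critical one. -/
theorem exists_sobolev_const_of_contDiff (hN : 2 ≤ N) (hX : ∀ j, LocallyLipschitz (X j))
    (hconn : IsXConnected X) (hmetric : MetricEquivalent X)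
    (hdoubling : IsDoubling X Q) {CP ν : ℝ} (hν : 0 < ν) (hpoincare : PoincareIneq X CP ν)
    {Ω : Set (EuclideanSpace ℝ (Fin N))} (hΩ : IsOpen Ω) (hΩb : Bornology.IsBounded Ω)
    {p q : ℝ} (hp : 1 ≤ p) (hpq : p ≤ q) (hQ : Q * (1 / p - 1 / q) < 1) :
    ∃ C : ℝ≥0∞, C ≠ ⊤ ∧ ∀ u : EuclideanSpace ℝ (Fin N) → ℝ, ContDiff ℝ 1 u →
      HasCompactSupport u → tsupport u ⊆ Ω →
      eLpNorm u (ENNReal.ofReal q) (volume.restrict Ω) ≤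
        C * eLpNorm (xGrad X u) (ENNReal.ofReal p) (volume.restrict Ω) := by
  have hp0 : 0 < p := by linarith
  have hq0 : 0 < q := by linarith
  have hexp : 0 ≤ 1 / p - 1 / q := sub_nonneg.2 (one_div_le_one_div_of_le hp0 hpq)
  have hΩt : volume Ω ≠ ⊤ := hΩb.measure_lt_top.ne
  rcases eq_or_ne (volume Ω) 0 with hΩ0 | hΩ0
  · exact ⟨0, by simp, fun u _ _ _ => by simp [Measure.restrict_eq_zero.2 hΩ0]⟩
  -- The factor `2` in `M` is what later lets the mean over `B_R` be absorbed.
  obtain ⟨R, hR, hbig, c, hc0, hc⟩ := exists_radius hN hconn hmetric hdoubling hν hΩb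
    (M := 2 * volume Ω) (ENNReal.mul_ne_top (by simp) hΩt)
  set A := ENNReal.ofReal (2 ^ Q) with hA
  have hA0 : A ≠ 0 := by simp [hA]; positivity
  have hAt : A ≠ ⊤ := ENNReal.ofReal_ne_top
  set r : ℕ → ℝ := fun i => R * 2⁻¹ ^ i with hr
  have hr0 : ∀ i, 0 < r i := fun i => by positivity
  -- `K i` bounds the `L^p`-to-`L^q` norm of the `i`-th term, the balls of radius `ν r i` having
  -- volume at least `c / A ^ i`.
  set K : ℕ → ℝ≥0∞ := fun i => A * ENNReal.ofReal (CP * r i) *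
    (A ^ (1 / q) * (A ^ i * c⁻¹) ^ (1 / p - 1 / q)) with hK
  have hsum : ∑' i, K i ≠ ⊤ := by
    -- The `K i` form a geometric sequence of ratio `ρ`; subcriticality of `q` says exactly that `ρ
    -- < 1`.
    set ρ : ℝ≥0∞ := ENNReal.ofReal (2⁻¹ * (2 ^ Q) ^ (1 / p - 1 / q)) with hρ
    have hρ1 : ρ < 1 := by
      rw [hρ, ENNReal.ofReal_lt_one, ← Real.rpow_mul (by norm_num), inv_mul_lt_iff₀ (by norm_num),
        mul_one]
      calc (2 : ℝ) ^ (Q * (1 / p - 1 / q)) < 2 ^ (1 : ℝ) :=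
            Real.rpow_lt_rpow_of_exponent_lt (by norm_num) hQ
        _ = 2 := by simp
    have hKi : ∀ i, K i = A * ENNReal.ofReal (CP * R) * (A ^ (1 / q) * c⁻¹ ^ (1 / p - 1 / q)) *
        ρ ^ i := by
      intro i
      have h1 : ENNReal.ofReal (CP * r i) = ENNReal.ofReal (CP * R) * ENNReal.ofReal 2⁻¹ ^ i := by
        rw [← ENNReal.ofReal_pow (by norm_num), ← ENNReal.ofReal_mul' (by positivity), hr]
        congr 1; ring
      have h2 : ρ = ENNReal.ofReal 2⁻¹ * A ^ (1 / p - 1 / q) := by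
        rw [hρ, ENNReal.ofReal_mul (by norm_num), hA,
          ENNReal.ofReal_rpow_of_nonneg (by positivity) hexp]
      simp only [hK]
      rw [h1, h2, ENNReal.mul_rpow_of_nonneg _ _ hexp, mul_pow, ← ENNReal.rpow_natCast A i,
        ← ENNReal.rpow_mul, ← ENNReal.rpow_natCast (A ^ (1 / p - 1 / q)) i, ← ENNReal.rpow_mul,
        mul_comm (i : ℝ)]
      ring
    simp only [hKi]
    rw [ENNReal.tsum_mul_left, ENNReal.tsum_geometric]
    have hc' : c⁻¹ ≠ ⊤ := ENNReal.inv_ne_top.2 hc0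
    refine ENNReal.mul_ne_top (ENNReal.mul_ne_top (ENNReal.mul_ne_top hAt ENNReal.ofReal_ne_top)
      (ENNReal.mul_ne_top (ENNReal.rpow_ne_top_of_nonneg (by positivity) hAt)
      (ENNReal.rpow_ne_top_of_nonneg hexp hc'))) ?_
    exact ENNReal.inv_ne_top.2 (tsub_pos_of_lt hρ1).ne'
  refine ⟨2 * ∑' i, K i, ENNReal.mul_ne_top (by simp) hsum, fun u hu hcu hsu => ?_⟩
  have hui : Integrable u := hu.continuous.integrable_of_hasCompactSupport hcu
  have hum : MemLp u (ENNReal.ofReal q) (volume.restrict Ω) :=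
    (hu.continuous.memLp_of_hasCompactSupport hcu).restrict Ω
  set g : EuclideanSpace ℝ (Fin N) → ℝ≥0∞ := fun y => ‖xGrad X u y‖ₑ with hg
  have hgm : Measurable g := (continuous_xGrad hX hu).measurable.enorm
  set F : ℕ → EuclideanSpace ℝ (Fin N) → ℝ≥0∞ := fun i x =>
    A * ENNReal.ofReal (CP * r i) * ballAvg X (ν * r i) g x with hF
  have hFm : ∀ i, Measurable (F i) := fun i =>
    (measurable_ballAvg hconn hmetric _ hgm).const_mul _
  set T : EuclideanSpace ℝ (Fin N) → ℝ≥0∞ := fun x => ∑' i, F i x with hT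
  have hTm : Measurable T := Measurable.tsum hFm
  set n := eLpNorm u (ENNReal.ofReal q) (volume.restrict Ω) with hn
  have hq0' : ENNReal.ofReal q ≠ 0 := (ENNReal.ofReal_pos.2 hq0).ne'
  have hgrad : (∫⁻ y, g y ^ p) ^ (1 / p) =
      eLpNorm (xGrad X u) (ENNReal.ofReal p) (volume.restrict Ω) := by
    rw [eLpNorm_restrict_eq_of_support_subset ((support_xGrad_subset u).trans hsu),
      eLpNorm_eq_lintegral_rpow_enorm_toReal (ENNReal.ofReal_pos.2 hp0).ne' ENNReal.ofReal_ne_top,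
      ENNReal.toReal_ofReal hp0.le]
  have hTn : eLpNorm T (ENNReal.ofReal q) (volume.restrict Ω) ≤
      (∑' i, K i) * eLpNorm (xGrad X u) (ENNReal.ofReal p) (volume.restrict Ω) := by
    rw [eLpNorm_eq_lintegral_rpow_enorm_toReal hq0' ENNReal.ofReal_ne_top,
      ENNReal.toReal_ofReal hq0.le, ← ENNReal.tsum_mul_right]
    simp only [enorm_eq_self]
    refine (lintegral_tsum_rpow_le (hp.trans hpq) hFm).trans (ENNReal.tsum_le_tsum fun i => ?_)
    have hb := lintegral_ballAvg_rpow_le hconn hmetric hdoubling (mul_pos hν (hr0 i)) hp hpq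
      hΩ.measurableSet (b := c / A ^ i) (fun x hx => ENNReal.div_le_of_le_mul' (hc x hx i)) hgm
    rw [hgrad, ENNReal.inv_div (Or.inl (ENNReal.pow_ne_top hAt)) (Or.inl (pow_ne_zero _ hA0)),
      div_eq_mul_inv (A ^ i)] at hb
    simp only [hF, hK]
    rw [lintegral_congr fun x => ENNReal.mul_rpow_of_nonneg _ _ hq0.le,
      lintegral_const_mul _ ((measurable_ballAvg hconn hmetric _ hgm).pow_const q),
      ENNReal.mul_rpow_of_nonneg _ _ (by positivity), ← ENNReal.rpow_mul,
      mul_one_div_cancel hq0.ne', ENNReal.rpow_one, mul_assoc (A * _)]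
    gcongr
  set κ : ℝ≥0∞ := (∫⁻ y in Ω, ‖u y‖ₑ) / (2 * volume Ω) with hκ
  have hpt : ∀ᵐ x ∂(volume.restrict Ω), ‖u x‖ₑ ≤ ‖κ + T x‖ₑ := by
    filter_upwards [ae_restrict_mem hΩ.measurableSet] with x hx
    refine (enorm_le_average_add_tsum hconn hmetric hdoubling hpoincare hu hui x hR).trans ?_
    rw [enorm_eq_self]
    refine add_le_add ?_ le_rfl
    have hs : ∫⁻ y in Ω, ‖u y‖ₑ = ∫⁻ y, ‖u y‖ₑ := by
      have := eLpNorm_restrict_eq_of_support_subset (p := 1) (μ := volume)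
        ((subset_tsupport u).trans hsu)
      simpa only [eLpNorm_one_eq_lintegral_enorm] using this
    rw [average_eq', hκ, hs]
    refine (enorm_integral_le_lintegral_enorm _).trans ?_
    rw [lintegral_smul_measure, smul_eq_mul, Measure.restrict_apply_univ, ENNReal.div_eq_inv_mul]
    gcongr
    · exact hbig x hx
    · exact Measure.restrict_le_self
  -- By Hölder, `‖u‖₁ ≤ n |Ω|^{1-1/q}`; dividing by `2|Ω|` leaves half of `n`.
  have hκn : eLpNorm (fun _ : EuclideanSpace ℝ (Fin N) => κ) (ENNReal.ofReal q)
      (volume.restrict Ω) ≤ 2⁻¹ * n := by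
    rw [eLpNorm_const' _ hq0' ENNReal.ofReal_ne_top, enorm_eq_self, ENNReal.toReal_ofReal hq0.le,
      Measure.restrict_apply_univ]
    have h1 := eLpNorm_le_eLpNorm_mul_rpow_measure_univ (μ := volume.restrict Ω)
      (p := 1) (q := ENNReal.ofReal q) (by simpa using hp.trans hpq) hum.1
    rw [eLpNorm_one_eq_lintegral_enorm, Measure.restrict_apply_univ, ENNReal.toReal_ofReal hq0.le,
      ENNReal.toReal_one, div_one] at h1
    calc κ * volume Ω ^ (1 / q)
        ≤ n * volume Ω ^ (1 - 1 / q) / (2 * volume Ω) * volume Ω ^ (1 / q) := by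
          rw [hκ]; gcongr
      _ = n / (2 * volume Ω) * (volume Ω ^ (1 - 1 / q) * volume Ω ^ (1 / q)) := by
          simp only [div_eq_mul_inv]; ring
      _ = n * (2⁻¹ * (volume Ω)⁻¹) * volume Ω := by
          rw [← ENNReal.rpow_add _ _ hΩ0 hΩt, sub_add_cancel, ENNReal.rpow_one, div_eq_mul_inv,
            ENNReal.mul_inv (by simp) (by simp)]
      _ = 2⁻¹ * n * ((volume Ω)⁻¹ * volume Ω) := by ring
      _ = 2⁻¹ * n := by rw [ENNReal.inv_mul_cancel hΩ0 hΩt, mul_one]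
  have hmain : n ≤ 2⁻¹ * n +
      (∑' i, K i) * eLpNorm (xGrad X u) (ENNReal.ofReal p) (volume.restrict Ω) := by
    calc n ≤ eLpNorm ((fun _ => κ) + T) (ENNReal.ofReal q) (volume.restrict Ω) :=
          eLpNorm_mono_enorm_ae hpt
      _ ≤ _ := (eLpNorm_add_le aestronglyMeasurable_const hTm.aestronglyMeasurable
          (by simpa using hp.trans hpq)).trans (add_le_add hκn hTn)
  have hhalf : n = 2⁻¹ * n + 2⁻¹ * n := by
    rw [← add_mul, ENNReal.inv_two_add_inv_two, one_mul]
  -- Absorption requires `n` finite, which holds because `u` is continuous with compact support.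
  have hfin : 2⁻¹ * n ≠ ⊤ := ENNReal.mul_ne_top (by simp) hum.2.ne
  have h3 : 2⁻¹ * n ≤ (∑' i, K i) * eLpNorm (xGrad X u) (ENNReal.ofReal p)
      (volume.restrict Ω) := by
    nth_rw 1 [hhalf] at hmain
    exact (ENNReal.add_le_add_iff_left hfin).1 hmain
  rw [mul_assoc, hhalf, two_mul]
  exact add_le_add h3 h3

end XElliptic

/-! ### Smooth truncations, and calculus in `W₀^{1,p}(Ω, X)`. -/

/-- A smooth function that vanishes on `[-k, k]`, is nondecreasing with slope at most `1`, and
has slope `1` outside `[-k', k']`. -/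
theorem exists_smooth_truncation {k k' : ℝ} (hk : 0 ≤ k) (hkk' : k < k') :
    ∃ Ψ : ℝ → ℝ, ContDiff ℝ ∞ Ψ ∧ (∀ t, 0 ≤ deriv Ψ t ∧ deriv Ψ t ≤ 1) ∧
      (∀ t, |t| ≤ k → Ψ t = 0) ∧ ∀ t, |t| - k' ≤ |Ψ t| := by
  set τ : ℝ → ℝ := fun s => Real.smoothTransition ((s - k) / (k' - k)) with hτ
  have hpos : 0 < k' - k := sub_pos.2 hkk'
  have hτs : ContDiff ℝ ∞ τ :=
    Real.smoothTransition.contDiff.comp ((contDiff_id.sub contDiff_const).div_const _)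
  have hτ0 : ∀ s ≤ k, τ s = 0 := fun s hs =>
    Real.smoothTransition.zero_of_nonpos (div_nonpos_of_nonpos_of_nonneg (by linarith) hpos.le)
  have hτ1 : ∀ s, k' ≤ s → τ s = 1 := fun s hs =>
    Real.smoothTransition.one_of_one_le ((one_le_div hpos).2 (by linarith))
  set Φ : ℝ → ℝ := fun t => ∫ s in (0 : ℝ)..t, τ s with hΦ
  have hΦd : ∀ t, HasDerivAt Φ (τ t) t := fun t =>
    intervalIntegral.integral_hasDerivAt_right (hτs.continuous.intervalIntegrable _ _)
      (hτs.continuous.stronglyMeasurableAtFilter _ _) hτs.continuous.continuousAt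
  have hΦs : ContDiff ℝ ∞ Φ := by
    rw [contDiff_infty_iff_deriv]
    exact ⟨fun t => (hΦd t).differentiableAt, by rwa [funext fun t => (hΦd t).deriv]⟩
  have hΦ0 : ∀ t ≤ k, Φ t = 0 := fun t ht => by
    rw [hΦ]
    refine (intervalIntegral.integral_congr (g := fun _ => (0 : ℝ)) fun s hs => ?_).trans (by simp)
    exact hτ0 s (hs.2.trans (max_le hk ht))
  have hΦ1 : ∀ t, 0 ≤ t → t - k' ≤ Φ t := fun t ht => by
    have hnn : ∀ s, 0 ≤ s → 0 ≤ Φ s := fun s hs =>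
      intervalIntegral.integral_nonneg hs fun _ _ => Real.smoothTransition.nonneg _
    rcases le_total t k' with h | h
    · linarith [hnn t ht]
    · have hsplit : Φ k' + ∫ s in k'..t, τ s = Φ t :=
        intervalIntegral.integral_add_adjacent_intervals (hτs.continuous.intervalIntegrable _ _)
          (hτs.continuous.intervalIntegrable _ _)
      have : ∫ s in k'..t, τ s = t - k' := by
        rw [intervalIntegral.integral_congr (g := fun _ => (1 : ℝ)) fun s hs => ?_]
        · simp
        · rw [Set.uIcc_of_le h] at hs
          exact hτ1 s hs.1
      linarith [hnn k' (by linarith)]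
  -- The truncation is the odd combination of `Φ`. As `k ≥ 0`, at most one of `τ t` and `τ (-t)` is
  -- nonzero, so the slope stays at most `1`.
  have hd : ∀ t, HasDerivAt (fun t => Φ t - Φ (-t)) (τ t + τ (-t)) t := fun t => by
    have := (hΦd t).sub ((hΦd (-t)).scomp t (hasDerivAt_neg t))
    simpa [Function.comp_def] using! this
  refine ⟨fun t => Φ t - Φ (-t), hΦs.sub (hΦs.comp contDiff_neg), fun t => ?_, fun t ht => ?_,
    fun t => ?_⟩
  · rw [(hd t).deriv]
    refine ⟨add_nonneg (Real.smoothTransition.nonneg _) (Real.smoothTransition.nonneg _), ?_⟩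
    rcases le_total t 0 with h | h
    · rw [hτ0 t (h.trans hk), zero_add]; exact Real.smoothTransition.le_one _
    · rw [hτ0 (-t) (by linarith), add_zero]; exact Real.smoothTransition.le_one _
  · rw [abs_le] at ht
    dsimp only
    rw [hΦ0 t ht.2, hΦ0 (-t) (by linarith), sub_zero]
  · dsimp only
    rcases le_total t 0 with h | h
    · rw [hΦ0 t (h.trans hk), zero_sub, abs_neg, abs_of_nonpos h]
      exact (hΦ1 (-t) (by linarith)).trans (le_abs_self _)
    · rw [hΦ0 (-t) (by linarith), sub_zero, abs_of_nonneg h]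
      exact (hΦ1 t h).trans (le_abs_self _)

namespace XElliptic

variable {N d : ℕ} {X : Fin d → EuclideanSpace ℝ (Fin N) → EuclideanSpace ℝ (Fin N)} {Q : ℝ}

/-- Fatou along an almost everywhere convergent subsequence of test functions suffices; convergence
in `L^q` is not needed. -/
theorem exists_sobolev_const (hN : 2 ≤ N) (hX : ∀ j, LocallyLipschitz (X j))
    (hconn : IsXConnected X) (hmetric : MetricEquivalent X)
    (hdoubling : IsDoubling X Q) {CP ν : ℝ} (hν : 0 < ν) (hpoincare : PoincareIneq X CP ν)
    {Ω : Set (EuclideanSpace ℝ (Fin N))} (hΩ : IsOpen Ω) (hΩb : Bornology.IsBounded Ω)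
    {p q : ℝ} (hp : 1 ≤ p) (hpq : p ≤ q) (hQ : Q * (1 / p - 1 / q) < 1) :
    ∃ C : ℝ≥0∞, C ≠ ⊤ ∧ ∀ u U, IsSobolevZero X Ω p u U →
      eLpNorm u (ENNReal.ofReal q) (volume.restrict Ω) ≤
        C * eLpNorm U (ENNReal.ofReal p) (volume.restrict Ω) := by
  obtain ⟨C, hC, h⟩ := exists_sobolev_const_of_contDiff hN hX hconn hmetric hdoubling hν hpoincare
    hΩ hΩb hp hpq hQ
  refine ⟨C, hC, fun u U ⟨hu, hU, φ, hφ, hφu, hφU⟩ => ?_⟩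
  have hp1 : 1 ≤ ENNReal.ofReal p := by simpa using hp
  have hφm : ∀ n, AEStronglyMeasurable (φ n) (volume.restrict Ω) := fun n =>
    (hφ n).1.continuous.aestronglyMeasurable
  obtain ⟨ns, hns, hae⟩ := (tendstoInMeasure_of_tendsto_eLpNorm (by positivity) hφm hu.1
    hφu).exists_seq_tendsto_ae
  refine (Lp.eLpNorm_lim_le_liminf_eLpNorm (fun n => hφm (ns n)) u hae).trans ?_
  have hb : ∀ n, eLpNorm (φ (ns n)) (ENNReal.ofReal q) (volume.restrict Ω) ≤
      C * (eLpNorm (fun x => xGrad X (φ (ns n)) x - U x) (ENNReal.ofReal p) (volume.restrict Ω) +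
        eLpNorm U (ENNReal.ofReal p) (volume.restrict Ω)) := fun n => by
    have h1 : ContDiff ℝ 1 (φ (ns n)) := (hφ _).1.of_le (by exact_mod_cast le_top)
    refine (h _ h1 (hφ _).2.1 (hφ _).2.2).trans ?_
    gcongr
    refine le_trans (le_of_eq ?_) (eLpNorm_add_le
      ((continuous_xGrad hX h1).aestronglyMeasurable.sub hU.1) hU.1 hp1)
    congr 1
    ext1 x
    simp
  have hlim := ENNReal.Tendsto.const_mul ((hφU.comp hns.tendsto_atTop).add_const
    (eLpNorm U (ENNReal.ofReal p) (volume.restrict Ω))) (Or.inr hC)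
  rw [zero_add] at hlim
  rw [← hlim.liminf_eq]
  exact liminf_le_liminf (Eventually.of_forall hb)

theorem xGrad_comp {Ψ : ℝ → ℝ} (hΨ : Differentiable ℝ Ψ) {u : EuclideanSpace ℝ (Fin N) → ℝ}
    (hu : Differentiable ℝ u) (x : EuclideanSpace ℝ (Fin N)) :
    xGrad X (fun y => Ψ (u y)) x = deriv Ψ (u x) • xGrad X u x := by
  have h : HasFDerivAt (fun y => Ψ (u y)) (deriv Ψ (u x) • fderiv ℝ u x) x :=
    (hΨ (u x)).hasDerivAt.comp_hasFDerivAt x (hu x).hasFDerivAt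
  ext j
  simp [xGrad, h.fderiv]

/-- The chain rule in `W₀^{1,p}(Ω, X)`. -/
theorem IsSobolevZero.comp_smooth (hX : ∀ j, LocallyLipschitz (X j))
    {Ω : Set (EuclideanSpace ℝ (Fin N))} {p : ℝ} (hp : 1 ≤ p)
    {u : EuclideanSpace ℝ (Fin N) → ℝ}
    {U : EuclideanSpace ℝ (Fin N) → EuclideanSpace ℝ (Fin d)} (h : IsSobolevZero X Ω p u U)
    {Ψ : ℝ → ℝ} (hΨ : ContDiff ℝ ∞ Ψ) (hΨ0 : Ψ 0 = 0) (hΨ1 : ∀ t, ‖deriv Ψ t‖ ≤ 1) :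
    IsSobolevZero X Ω p (fun x => Ψ (u x)) fun x => deriv Ψ (u x) • U x := by
  obtain ⟨hu, hU, φ, hφ, hφu, hφU⟩ := h
  have hp0 : 0 < p := by linarith
  have hp1 : 1 ≤ ENNReal.ofReal p := by simpa using hp
  have hp0' : ENNReal.ofReal p ≠ 0 := (ENNReal.ofReal_pos.2 hp0).ne'
  have hΨd : Differentiable ℝ Ψ := hΨ.differentiable (by simp)
  have hΨc : Continuous (deriv Ψ) := hΨ.continuous_deriv (by exact_mod_cast le_top)
  have hlip : LipschitzWith 1 Ψ := lipschitzWith_of_nnnorm_deriv_le hΨd fun t => hΨ1 t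
  have hΨu : AEStronglyMeasurable (fun x => deriv Ψ (u x)) (volume.restrict Ω) :=
    hΨc.comp_aestronglyMeasurable hu.1
  have hφm : ∀ n, AEStronglyMeasurable (φ n) (volume.restrict Ω) := fun n =>
    (hφ n).1.continuous.aestronglyMeasurable
  have hφ1 : ∀ n, ContDiff ℝ 1 (φ n) := fun n => (hφ n).1.of_le (by exact_mod_cast le_top)
  -- The approximants are `Ψ ∘ φ`, again test functions because `Ψ` is smooth with `Ψ 0 = 0`.
  -- Pointwise convergence is needed to pass to the limit in `deriv Ψ`.
  obtain ⟨ns, hns, hae⟩ := (tendstoInMeasure_of_tendsto_eLpNorm hp0' hφm hu.1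
    hφu).exists_seq_tendsto_ae
  refine ⟨hu.of_le (hΨ.continuous.comp_aestronglyMeasurable hu.1) (Eventually.of_forall fun x => ?_),
    hU.of_le (hΨu.smul hU.1) (Eventually.of_forall fun x => ?_),
    fun n x => Ψ (φ (ns n) x), fun n => ⟨hΨ.comp (hφ _).1, (hφ _).2.1.comp_left hΨ0,
      (closure_mono (Function.support_comp_subset hΨ0 _)).trans (hφ (ns n)).2.2⟩, ?_, ?_⟩
  · simpa [hΨ0] using hlip.dist_le_mul (u x) 0
  · rw [norm_smul]
    exact mul_le_of_le_one_left (norm_nonneg _) (hΨ1 _)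
  · refine tendsto_of_tendsto_of_tendsto_of_le_of_le tendsto_const_nhds
      (hφu.comp hns.tendsto_atTop) (fun _ => zero_le) fun n => eLpNorm_mono fun x => ?_
    simpa [dist_eq_norm] using hlip.dist_le_mul (φ (ns n) x) (u x)
  -- The gradient error is `Ψ'(φ)(Xφ - U) + (Ψ'(φ) - Ψ'(u))U`. The first part is controlled by `|Ψ'|
  -- ≤ 1`, the second by dominated convergence with majorant `2|U|`.
  · have hdc : Tendsto (fun n => eLpNorm (fun x => (deriv Ψ (φ (ns n) x) - deriv Ψ (u x)) • U x)
        (ENNReal.ofReal p) (volume.restrict Ω)) atTop (𝓝 0) := by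
      have hbound : ∀ s t : ℝ, ‖deriv Ψ s - deriv Ψ t‖ₑ ≤ 2 := fun s t => by
        rw [← ofReal_norm]
        refine ENNReal.ofReal_le_of_le_toReal ?_
        simpa using (norm_sub_le _ _).trans (by linarith [hΨ1 s, hΨ1 t] :
          ‖deriv Ψ s‖ + ‖deriv Ψ t‖ ≤ 2)
      have hlint : Tendsto (fun n => ∫⁻ x in Ω,
          ‖(deriv Ψ (φ (ns n) x) - deriv Ψ (u x)) • U x‖ₑ ^ p) atTop (𝓝 (∫⁻ _ in Ω, 0)) := by
        refine tendsto_lintegral_of_dominated_convergence' (fun x => (2 * ‖U x‖ₑ) ^ p)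
          (fun n => ?_) (fun n => Eventually.of_forall fun x => ?_) ?_ ?_
        · exact ((((hΨc.comp_aestronglyMeasurable (hφm (ns n))).sub hΨu).smul
            hU.1).enorm).pow_const p
        · dsimp only
          rw [enorm_smul]
          gcongr
          exact hbound _ _
        · have := lintegral_rpow_enorm_lt_top_of_eLpNorm_lt_top hp0' ENNReal.ofReal_ne_top hU.2
          rw [ENNReal.toReal_ofReal hp0.le] at this
          rw [lintegral_congr fun x => ENNReal.mul_rpow_of_nonneg _ _ hp0.le,
            lintegral_const_mul' _ _ (ENNReal.rpow_ne_top_of_nonneg hp0.le (by simp))]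
          exact ENNReal.mul_ne_top (ENNReal.rpow_ne_top_of_nonneg hp0.le (by simp)) this.ne
        · filter_upwards [hae] with x hx
          have h1 : Tendsto (fun n => (deriv Ψ (φ (ns n) x) - deriv Ψ (u x)) • U x) atTop
              (𝓝 ((deriv Ψ (u x) - deriv Ψ (u x)) • U x)) :=
            (((hΨc.tendsto (u x)).comp hx).sub_const _).smul_const _
          have h2 := (ENNReal.continuous_rpow_const (y := p)).tendsto _ |>.comp h1.enorm
          simpa [Function.comp_def, hp0] using h2
      have h3 := (ENNReal.continuous_rpow_const (y := 1 / p)).tendsto _ |>.comp hlint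
      simp only [eLpNorm_eq_lintegral_rpow_enorm_toReal hp0' ENNReal.ofReal_ne_top,
        ENNReal.toReal_ofReal hp0.le]
      simpa [Function.comp_def, hp0] using h3
    have hsum := (hφU.comp hns.tendsto_atTop).add hdc
    rw [add_zero] at hsum
    refine tendsto_of_tendsto_of_tendsto_of_le_of_le tendsto_const_nhds hsum
      (fun _ => zero_le) fun n => ?_
    have hΨφ : AEStronglyMeasurable (fun x => deriv Ψ (φ (ns n) x)) (volume.restrict Ω) :=
      hΨc.comp_aestronglyMeasurable (hφm _)
    have hGU : AEStronglyMeasurable (fun x => xGrad X (φ (ns n)) x - U x) (volume.restrict Ω) :=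
      (continuous_xGrad hX (hφ1 _)).aestronglyMeasurable.sub hU.1
    have heq : (fun x => xGrad X (fun y => Ψ (φ (ns n) y)) x - deriv Ψ (u x) • U x) =
        (fun x => deriv Ψ (φ (ns n) x) • (xGrad X (φ (ns n)) x - U x)) +
          fun x => (deriv Ψ (φ (ns n) x) - deriv Ψ (u x)) • U x := by
      funext x
      rw [xGrad_comp hΨd ((hφ1 (ns n)).differentiable one_ne_zero)]
      simp only [Pi.add_apply, smul_sub, sub_smul]
      abel
    rw [heq]
    refine (eLpNorm_add_le (hΨφ.smul hGU) ((hΨφ.sub hΨu).smul hU.1) hp1).trans ?_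
    refine add_le_add (eLpNorm_mono fun x => ?_) le_rfl
    rw [Pi.smul_apply', norm_smul]
    exact mul_le_of_le_one_left (norm_nonneg _) (hΨ1 _)

end XElliptic

/-! ### Two tools: superposition operators and Stampacchia's iteration. -/

/-- Superposition with a Carathéodory function preserves measurability. -/
theorem MeasureTheory.AEStronglyMeasurable.comp_caratheodory {α Z F : Type*} [MeasurableSpace α]
    {μ : Measure α} [TopologicalSpace Z] [NormedAddCommGroup F] {a : α → Z → F}
    (ha : ∀ z, AEStronglyMeasurable (fun x => a x z) μ)
    (hc : ∀ᵐ x ∂μ, Continuous (a x)) {z : α → Z} (hz : AEStronglyMeasurable z μ) :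
    AEStronglyMeasurable (fun x => a x (z x)) μ := by
  have hsimple : ∀ s : SimpleFunc α Z, AEStronglyMeasurable (fun x => a x (s x)) μ := fun s => by
    classical
    have h : (fun x => a x (s x)) =
        fun x => ∑ c ∈ s.range, (s ⁻¹' {c}).indicator (fun x => a x c) x := by
      funext x
      rw [Finset.sum_eq_single (s x)]
      · simp
      · intro c _ hcx
        exact Set.indicator_of_notMem (fun h => hcx h.symm) _
      · intro h
        exact absurd (s.mem_range_self x) h
    rw [h]
    exact Finset.aestronglyMeasurable_fun_sum _ fun c _ =>
      (ha c).indicator (s.measurableSet_preimage {c})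
  refine aestronglyMeasurable_of_tendsto_ae atTop
    (fun n => hsimple (hz.stronglyMeasurable_mk.approx n)) ?_
  filter_upwards [hc, hz.ae_eq_mk] with x hx hzx
  rw [hzx]
  exact (hx.tendsto _).comp (hz.stronglyMeasurable_mk.tendsto_approx x)

/-- Stampacchia's lemma. -/
theorem eq_zero_of_decay {ψ : ℝ → ℝ} (hψ0 : ∀ k, 0 ≤ ψ k) (hanti : Antitone ψ) {P K b e M : ℝ}
    (hP : ψ 0 ≤ P) (hb : 1 < b) (he : 0 < e) (hM : 0 < M) (hK : 0 ≤ K)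
    (hdecay : ∀ k h, 0 ≤ k → k < h → (h - k) ^ e * ψ h ≤ K * ψ k ^ b)
    (hKM : K * 2 ^ e * P ^ (b - 1) * 2 ^ (e / (b - 1)) ≤ M ^ e) : ψ M = 0 := by
  have hb0 : 0 < b - 1 := by linarith
  have hP0 : 0 ≤ P := (hψ0 0).trans hP
  -- Along the levels `M(1 - 2⁻ʲ)` the gaps cost a factor `2 ^ e` per step. The ratio `l` solves `2
  -- ^ e * l ^ (b - 1) = 1`, so the bound `P * l ^ j` reproduces itself.
  set l : ℝ := 2 ^ (-(e / (b - 1))) with hl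
  have hl0 : 0 < l := by positivity
  have hl1 : l < 1 := Real.rpow_lt_one_of_one_lt_of_neg (by norm_num) (by simp; positivity)
  have hlb : 2 ^ e * l ^ (b - 1) = 1 := by
    rw [hl, ← Real.rpow_mul (by norm_num), ← Real.rpow_add (by norm_num)]
    simp [hb0.ne']
  have hll : 2 ^ (e / (b - 1)) * l = 1 := by
    rw [hl, ← Real.rpow_add (by norm_num)]; simp
  have hstep : ∀ j : ℕ, ψ (M * (1 - 2⁻¹ ^ j)) ≤ P * l ^ j := by
    intro j
    induction j with
    | zero => simpa using hP
    | succ j ih =>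
      have hpow : (2⁻¹ : ℝ) ^ j ≤ 1 := pow_le_one₀ (by norm_num) (by norm_num)
      have hpow' : (0 : ℝ) < 2⁻¹ ^ j := by positivity
      have h := hdecay (M * (1 - 2⁻¹ ^ j)) (M * (1 - 2⁻¹ ^ (j + 1)))
        (mul_nonneg hM.le (by linarith)) (mul_lt_mul_of_pos_left (by rw [pow_succ]; linarith) hM)
      set D : ℝ := M * 2⁻¹ ^ (j + 1) with hD
      have hdiff : M * (1 - 2⁻¹ ^ (j + 1)) - M * (1 - 2⁻¹ ^ j) = D := by
        rw [hD, pow_succ]; ring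
      have hD0 : 0 < D ^ e := by positivity
      rw [hdiff] at h
      have h2 : K * ψ (M * (1 - 2⁻¹ ^ j)) ^ b ≤ K * (P * l ^ j) ^ b := by
        gcongr
        exact hψ0 _
      have h3 : K * (P * l ^ j) ^ b ≤ D ^ e * (P * l ^ (j + 1)) := by
        have e1 : D ^ e = M ^ e * (2 ^ e)⁻¹ * ((2 ^ e) ^ j)⁻¹ := by
          rw [hD, Real.mul_rpow hM.le (by positivity), pow_succ, Real.mul_rpow (by positivity)
            (by norm_num), ← Real.rpow_pow_comm (by norm_num), Real.inv_rpow (by norm_num), inv_pow]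
          ring
        have e2 : P ^ b = P ^ (b - 1) * P := by
          rcases hP0.eq_or_lt with h0 | h0
          · rw [← h0, mul_zero, Real.zero_rpow (by linarith)]
          · rw [← Real.rpow_add_one h0.ne', sub_add_cancel]
        have e3 : (l ^ j) ^ b = (l ^ (b - 1)) ^ j * l ^ j := by
          rw [← Real.rpow_pow_comm hl0.le, ← mul_pow, ← Real.rpow_add_one hl0.ne', sub_add_cancel]
        have e4 : (2 ^ e) ^ j * (l ^ (b - 1)) ^ j = 1 := by rw [← mul_pow, hlb, one_pow]
        have e5 : (l ^ (b - 1)) ^ j = (((2 : ℝ) ^ e) ^ j)⁻¹ := eq_inv_of_mul_eq_one_right e4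
        rw [Real.mul_rpow hP0 (by positivity), e1, e2, e3, e5]
        calc K * (P ^ (b - 1) * P * (((2 ^ e) ^ j)⁻¹ * l ^ j))
            = (K * 2 ^ e * P ^ (b - 1) * 2 ^ (e / (b - 1))) * ((2 ^ e)⁻¹ * ((2 ^ e) ^ j)⁻¹ *
              (P * (l ^ j * l))) := by
              have h2e : (2 : ℝ) ^ e * (2 ^ e)⁻¹ = 1 := mul_inv_cancel₀ (by positivity)
              linear_combination (-(K * P ^ (b - 1) * P * ((2 ^ e) ^ j)⁻¹ * l ^ j)) *
                (h2e + 2 ^ e * (2 ^ e)⁻¹ * hll)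
          _ ≤ M ^ e * ((2 ^ e)⁻¹ * ((2 ^ e) ^ j)⁻¹ * (P * (l ^ j * l))) := by gcongr
          _ = _ := by rw [pow_succ]; ring
      exact le_of_mul_le_mul_left (h.trans (h2.trans h3)) hD0
  have hlim : Tendsto (fun j : ℕ => P * l ^ j) atTop (𝓝 (P * 0)) :=
    (tendsto_pow_atTop_nhds_zero_of_lt_one hl0.le hl1).const_mul P
  rw [mul_zero] at hlim
  refine le_antisymm (ge_of_tendsto' hlim fun j => (hanti ?_).trans (hstep j)) (hψ0 M)
  have : (0 : ℝ) ≤ 2⁻¹ ^ j := by positivity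
  nlinarith

/-! ### Energy estimate and decay of the superlevel sets. -/

namespace XElliptic

variable {N d : ℕ} {X : Fin d → EuclideanSpace ℝ (Fin N) → EuclideanSpace ℝ (Fin N)} {Q : ℝ}
  {Ω : Set (EuclideanSpace ℝ (Fin N))} {p α β : ℝ} {h f u : EuclideanSpace ℝ (Fin N) → ℝ}
  {a : EuclideanSpace ℝ (Fin N) → ℝ → EuclideanSpace ℝ (Fin d) → EuclideanSpace ℝ (Fin d)}
  {U V : EuclideanSpace ℝ (Fin N) → EuclideanSpace ℝ (Fin d)}

/-- Growth puts `a(x, u, U)` in `L^{p'}`, and Hölder applies. This excludes the default value `0` of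
the integral in the weak formulation. The growth condition enters only here, so the final constant
is free of `β` and `h`. -/
theorem IsLerayLions.integrable_inner (ha : IsLerayLions Ω p α β h a) (hp : 1 < p)
    (hu : MemLp u (ENNReal.ofReal p) (volume.restrict Ω))
    (hU : MemLp U (ENNReal.ofReal p) (volume.restrict Ω))
    (hV : MemLp V (ENNReal.ofReal p) (volume.restrict Ω)) :
    Integrable (fun x => inner ℝ (a x (u x) (U x)) (V x)) (volume.restrict Ω) := by
  have hp1 : 0 < p - 1 := by linarith
  have hm : AEStronglyMeasurable (fun x => a x (u x) (U x)) (volume.restrict Ω) :=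
    AEStronglyMeasurable.comp_caratheodory (a := fun x (z : ℝ × EuclideanSpace ℝ (Fin d)) =>
      a x z.1 z.2) (fun z => ha.measurable z.1 z.2) ha.continuous (hu.1.prodMk hU.1)
  have hexp : ENNReal.ofReal p / ENNReal.ofReal (p - 1) = ENNReal.ofReal (p / (p - 1)) :=
    (ENNReal.ofReal_div_of_pos hp1).symm
  have hu' := hu.norm_rpow_div (ENNReal.ofReal (p - 1))
  have hU' := hU.norm_rpow_div (ENNReal.ofReal (p - 1))
  rw [hexp, ENNReal.toReal_ofReal hp1.le] at hu' hU'
  have hb := ((ha.memLp.add hu').add hU').const_mul β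
  have hconj : (p / (p - 1)).HolderConjugate p :=
    (Real.HolderConjugate.conjExponent hp).symm
  have := hconj.ennrealOfReal
  refine (hb.integrable_mul hV.norm).mono' (hm.inner hV.1) ?_
  filter_upwards [ha.growth] with x hx
  refine (norm_inner_le_norm _ _).trans ?_
  simp only [Pi.mul_apply, Pi.add_apply]
  gcongr
  simpa using hx (u x) (U x)

/-- The energy estimate obtained by testing the equation with `Ψ(u)`. -/
theorem IsLerayLions.energy_le (ha : IsLerayLions Ω p α β h a) (hp : 1 < p)
    (hX : ∀ j, LocallyLipschitz (X j)) (hα : 0 < α) (hu : IsSobolevZero X Ω p u U)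
    (hweak : ∀ v V, IsSobolevZero X Ω p v V →
      ∫ x in Ω, inner ℝ (a x (u x) (U x)) (V x) = ∫ x in Ω, f x * v x)
    {Ψ : ℝ → ℝ} (hΨ : ContDiff ℝ ∞ Ψ) (hΨ0 : Ψ 0 = 0)
    (hΨ1 : ∀ t, 0 ≤ deriv Ψ t ∧ deriv Ψ t ≤ 1) :
    ENNReal.ofReal α * eLpNorm (fun x => deriv Ψ (u x) • U x) (ENNReal.ofReal p)
      (volume.restrict Ω) ^ p ≤ ∫⁻ x in Ω, ‖f x‖ₑ * ‖Ψ (u x)‖ₑ := by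
  have hp0 : 0 < p := by linarith
  have hv := hu.comp_smooth hX hp.le hΨ hΨ0 fun t => by
    rw [Real.norm_eq_abs, abs_of_nonneg (hΨ1 t).1]; exact (hΨ1 t).2
  have hint := ha.integrable_inner hp hu.1 hu.2.1 hv.2.1
  have hpt : ∀ᵐ x ∂(volume.restrict Ω), α * ‖deriv Ψ (u x) • U x‖ ^ p ≤
      inner ℝ (a x (u x) (U x)) (deriv Ψ (u x) • U x) := by
    filter_upwards [ha.coercive] with x hx
    obtain ⟨h0, h1⟩ := hΨ1 (u x)
    rw [inner_smul_right, norm_smul, Real.norm_eq_abs, abs_of_nonneg h0,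
      Real.mul_rpow h0 (norm_nonneg _)]
    -- Since `0 ≤ Ψ' ≤ 1` and `p ≥ 1`, `Ψ'^p ≤ Ψ'`: the single factor `Ψ'` from the test function
    -- controls the whole power.
    calc α * (deriv Ψ (u x) ^ p * ‖U x‖ ^ p) = deriv Ψ (u x) ^ p * (α * ‖U x‖ ^ p) := by ring
      _ ≤ deriv Ψ (u x) * (α * ‖U x‖ ^ p) := by
          gcongr
          exact (Real.rpow_le_rpow_of_exponent_ge' h0 h1 zero_le_one hp.le).trans_eq
            (Real.rpow_one _)
      _ ≤ _ := mul_le_mul_of_nonneg_left (hx _ _) h0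
  have hnn : 0 ≤ᵐ[volume.restrict Ω] fun x =>
      inner ℝ (a x (u x) (U x)) (deriv Ψ (u x) • U x) := by
    filter_upwards [hpt] with x hx using le_trans (by positivity) hx
  rw [eLpNorm_eq_lintegral_rpow_enorm_toReal (ENNReal.ofReal_pos.2 hp0).ne' ENNReal.ofReal_ne_top,
    ENNReal.toReal_ofReal hp0.le, ← ENNReal.rpow_mul, one_div_mul_cancel hp0.ne', ENNReal.rpow_one,
    ← lintegral_const_mul' _ _ ENNReal.ofReal_ne_top]
  calc ∫⁻ x in Ω, ENNReal.ofReal α * ‖deriv Ψ (u x) • U x‖ₑ ^ p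
      ≤ ∫⁻ x in Ω, ENNReal.ofReal (inner ℝ (a x (u x) (U x)) (deriv Ψ (u x) • U x)) := by
        refine lintegral_mono_ae ?_
        filter_upwards [hpt] with x hx
        rw [← ofReal_norm, ENNReal.ofReal_rpow_of_nonneg (norm_nonneg _) hp0.le,
          ← ENNReal.ofReal_mul hα.le]
        exact ENNReal.ofReal_le_ofReal hx
    _ = ENNReal.ofReal (∫ x in Ω, f x * Ψ (u x)) := by
        rw [← ofReal_integral_eq_lintegral_ofReal hint hnn, hweak _ _ hv]
    _ ≤ ‖∫ x in Ω, f x * Ψ (u x)‖ₑ := Real.ofReal_le_enorm _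
    _ ≤ _ := (enorm_integral_le_lintegral_enorm _).trans (by simp)

/-- Hölder on `A` with exponents `r = q / (q - 1)` and `q`, then from `L^r` to `L^m` at the price of
a power of `μ A`. For `m = ∞` the convention `1 / m.toReal = 0` gives the right exponent. -/
theorem lintegral_mul_le_of_eq_zero {E : Type*} [MeasurableSpace E] {μ : Measure E} {f v : E → ℝ}
    {q : ℝ} (hq : 1 < q) {m : ℝ≥0∞} (hqm : 1 / m.toReal ≤ 1 - 1 / q) (hm : 1 ≤ m)
    (hf : MemLp f m μ) (hv : AEStronglyMeasurable v μ) {A : Set E} (hA : NullMeasurableSet A μ)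
    (h0 : ∀ x ∉ A, v x = 0) :
    ∫⁻ x, ‖f x‖ₑ * ‖v x‖ₑ ∂μ ≤
      eLpNorm f m μ * μ A ^ (1 - 1 / q - 1 / m.toReal) * eLpNorm v (ENNReal.ofReal q) μ := by
  set r := q / (q - 1) with hr
  have hq0 : 0 < q := by linarith
  have hconj : r.HolderConjugate q := (Real.HolderConjugate.conjExponent hq).symm
  have hr0 : 0 < r := hconj.pos
  have hr1 : 1 / r = 1 - 1 / q := by
    have := hconj.inv_add_inv_eq_one
    simp only [one_div]; linarith
  have hrm : ENNReal.ofReal r ≤ m := by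
    rcases eq_or_ne m ⊤ with rfl | hmt
    · exact le_top
    · refine ENNReal.ofReal_le_of_le_toReal ?_
      have hm0 : 0 < m.toReal := ENNReal.toReal_pos (by positivity) hmt
      rw [← hr1] at hqm
      exact (one_div_le_one_div hm0 hr0).1 hqm
  calc ∫⁻ x, ‖f x‖ₑ * ‖v x‖ₑ ∂μ = ∫⁻ x in A, ‖f x‖ₑ * ‖v x‖ₑ ∂μ := by
        rw [← lintegral_indicator₀ hA]
        refine lintegral_congr fun x => ?_
        by_cases hx : x ∈ A
        · rw [Set.indicator_of_mem hx]
        · rw [Set.indicator_of_notMem hx, h0 x hx]; simp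
    _ ≤ (∫⁻ x in A, ‖f x‖ₑ ^ r ∂μ) ^ (1 / r) * (∫⁻ x in A, ‖v x‖ₑ ^ q ∂μ) ^ (1 / q) :=
        ENNReal.lintegral_mul_le_Lp_mul_Lq _ hconj hf.1.restrict.enorm hv.restrict.enorm
    _ ≤ (eLpNorm f m μ * μ A ^ (1 - 1 / q - 1 / m.toReal)) * eLpNorm v (ENNReal.ofReal q) μ := by
        have h1 := eLpNorm_le_eLpNorm_mul_rpow_measure_univ hrm hf.1.restrict (μ := μ.restrict A)
        rw [Measure.restrict_apply_univ, ENNReal.toReal_ofReal hr0.le, hr1,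
          eLpNorm_eq_lintegral_rpow_enorm_toReal (ENNReal.ofReal_pos.2 hr0).ne'
          ENNReal.ofReal_ne_top, ENNReal.toReal_ofReal hr0.le] at h1
        have h2 : eLpNorm v (ENNReal.ofReal q) (μ.restrict A) ≤ eLpNorm v (ENNReal.ofReal q) μ :=
          eLpNorm_mono_measure v Measure.restrict_le_self
        rw [eLpNorm_eq_lintegral_rpow_enorm_toReal (ENNReal.ofReal_pos.2 hq0).ne'
          ENNReal.ofReal_ne_top, ENNReal.toReal_ofReal hq0.le] at h2
        refine mul_le_mul' (h1.trans ?_) h2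
        gcongr
        exact Measure.restrict_le_self

/-- The decay of the measures of the superlevel sets of a weak solution. -/
theorem IsLerayLions.measure_superlevel_decay (ha : IsLerayLions Ω p α β h a) (hp : 1 < p)
    (hX : ∀ j, LocallyLipschitz (X j)) (hα : 0 < α) {q : ℝ} (hq : 1 < q) {m : ℝ≥0∞} (hm : 1 ≤ m)
    (hqm : 1 / m.toReal ≤ 1 - 1 / q) {C : ℝ≥0∞} (hC : C ≠ ⊤)
    (hsob : ∀ v V, IsSobolevZero X Ω p v V → eLpNorm v (ENNReal.ofReal q) (volume.restrict Ω) ≤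
      C * eLpNorm V (ENNReal.ofReal p) (volume.restrict Ω))
    (hf : MemLp f m (volume.restrict Ω)) (hu : IsWeakSolution X Ω p a f u)
    {k l : ℝ} (hk : 0 ≤ k) (hkl : k < l) :
    ENNReal.ofReal ((l - k) / 2) ^ (p - 1) *
        volume.restrict Ω {x | l < |u x|} ^ ((p - 1) / q) ≤
      C ^ p / ENNReal.ofReal α * eLpNorm f m (volume.restrict Ω) *
        volume.restrict Ω {x | k < |u x|} ^ (1 - 1 / q - 1 / m.toReal) := by
  obtain ⟨U, hU, hweak⟩ := hu
  have hp0 : 0 < p := by linarith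
  have hq0 : 0 < q := by linarith
  have hα0 : ENNReal.ofReal α ≠ 0 := (ENNReal.ofReal_pos.2 hα).ne'
  -- A smooth truncation needs room between the levels; the midpoint still leaves `|Ψ(u)| ≥ (l - k)
  -- / 2` on `{|u| > l}`.
  obtain ⟨Ψ, hΨ, hΨ1, hΨk, hΨl⟩ := exists_smooth_truncation hk
    (show k < (k + l) / 2 by linarith)
  have hΨ0 : Ψ 0 = 0 := hΨk 0 (by simpa using hk)
  set μ := volume.restrict Ω with hμ
  have hv := hU.comp_smooth hX hp.le hΨ hΨ0 fun t => by
    rw [Real.norm_eq_abs, abs_of_nonneg (hΨ1 t).1]; exact (hΨ1 t).2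
  have henergy := ha.energy_le hp hX hα hU hweak hΨ hΨ0 hΨ1
  have hS := hsob _ _ hv
  set n := eLpNorm (fun x => Ψ (u x)) (ENNReal.ofReal q) μ with hn
  have hnt : n ≠ ⊤ := (hS.trans_lt (ENNReal.mul_lt_top hC.lt_top hv.2.1.2)).ne
  have hA : NullMeasurableSet {x | k < |u x|} μ :=
    nullMeasurableSet_lt aemeasurable_const hU.1.1.norm.aemeasurable
  have hH := lintegral_mul_le_of_eq_zero hq hqm hm hf hv.1.1 hA
    fun x hx => hΨk (u x) (not_lt.1 hx)
  set D := eLpNorm f m μ * μ {x | k < |u x|} ^ (1 - 1 / q - 1 / m.toReal) with hD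
  have hnp : n ^ p ≤ C ^ p / ENNReal.ofReal α * D * n := by
    calc n ^ p ≤ (C * eLpNorm (fun x => deriv Ψ (u x) • U x) (ENNReal.ofReal p) μ) ^ p := by gcongr
      _ = C ^ p / ENNReal.ofReal α * (ENNReal.ofReal α *
          eLpNorm (fun x => deriv Ψ (u x) • U x) (ENNReal.ofReal p) μ ^ p) := by
        rw [ENNReal.mul_rpow_of_nonneg _ _ hp0.le, ← mul_assoc,
          ENNReal.div_mul_cancel hα0 ENNReal.ofReal_ne_top]
      _ ≤ C ^ p / ENNReal.ofReal α * (D * n) := mul_le_mul_right (henergy.trans hH) _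
      _ = _ := by ring
  -- One factor `n` is cancelled, which is legitimate because the Sobolev inequality makes `n`
  -- finite.
  have hn1 : n ^ (p - 1) ≤ C ^ p / ENNReal.ofReal α * D := by
    rcases eq_or_ne n 0 with h0 | h0
    · rw [h0, ENNReal.zero_rpow_of_pos (by linarith)]; exact zero_le
    · refine (ENNReal.mul_le_mul_iff_left h0 hnt).1 (le_trans (le_of_eq ?_) hnp)
      nth_rw 2 [← ENNReal.rpow_one n]
      rw [← ENNReal.rpow_add _ _ h0 hnt, sub_add_cancel]
  have hcheb : ENNReal.ofReal ((l - k) / 2) * μ {x | l < |u x|} ^ (1 / q) ≤ n := by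
    have h1 := mul_meas_ge_le_pow_eLpNorm' μ (ENNReal.ofReal_pos.2 hq0).ne' ENNReal.ofReal_ne_top
      hv.1.1 (ENNReal.ofReal ((l - k) / 2))
    rw [ENNReal.toReal_ofReal hq0.le] at h1
    have h2 : μ {x | l < |u x|} ≤ μ {x | ENNReal.ofReal ((l - k) / 2) ≤ ‖Ψ (u x)‖ₑ} := by
      refine measure_mono fun x (hx : l < |u x|) => ?_
      have := hΨl (u x)
      simp only [Set.mem_ofPred_eq]
      rw [← ofReal_norm]
      refine ENNReal.ofReal_le_ofReal ?_
      rw [Real.norm_eq_abs]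
      linarith
    have h3 : ENNReal.ofReal ((l - k) / 2) ^ q * μ {x | l < |u x|} ≤ n ^ q :=
      (mul_le_mul_right h2 _).trans h1
    have h4 := ENNReal.rpow_le_rpow h3 (one_div_nonneg.2 hq0.le)
    rwa [ENNReal.mul_rpow_of_nonneg _ _ (one_div_nonneg.2 hq0.le), ← ENNReal.rpow_mul,
      ← ENNReal.rpow_mul, mul_one_div_cancel hq0.ne', ENNReal.rpow_one, ENNReal.rpow_one] at h4
  calc _ = (ENNReal.ofReal ((l - k) / 2) * μ {x | l < |u x|} ^ (1 / q)) ^ (p - 1) := by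
        rw [ENNReal.mul_rpow_of_nonneg _ _ (by linarith), ← ENNReal.rpow_mul]
        congr 2; ring
    _ ≤ n ^ (p - 1) := by gcongr
    _ ≤ _ := hn1.trans_eq (by rw [hD]; ring)

/-- The choice of an exponent `q = 1 / y` that is Sobolev subcritical and large enough for the
right-hand side. -/
theorem exists_exponent (hp : 1 < p) (hpQ : p < Q) {m : ℝ≥0∞} (hm : ENNReal.ofReal (Q / p) < m) :
    ∃ q : ℝ, p ≤ q ∧ Q * (1 / p - 1 / q) < 1 ∧ p / q < 1 - 1 / m.toReal := by
  have hp0 : 0 < p := by linarith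
  have hQ0 : 0 < Q := by linarith
  set t := 1 / m.toReal with ht
  have ht0 : 0 ≤ t := by positivity
  have ht1 : t < p / Q := by
    rcases eq_or_ne m ⊤ with rfl | hmt
    · rw [ht]; simp; positivity
    · have h1 : Q / p < m.toReal := (ENNReal.ofReal_lt_iff_lt_toReal (by positivity) hmt).1 hm
      rw [ht, ← one_div_div Q p]
      exact one_div_lt_one_div_of_lt (by positivity) h1
  have hpQ1 : p / Q < 1 := (div_lt_one hQ0).2 hpQ
  have hpQ0 : 0 < p / Q := by positivity
  -- In terms of `y = p / q` the requirements read `1 - p / Q < y < 1 - t`; the interval is nonempty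
  -- because `m > Q / p`, and `y` is its midpoint.
  set y := ((1 - t) + (1 - p / Q)) / 2 with hy
  have hy0 : 0 < y := by rw [hy]; linarith
  refine ⟨p / y, ?_, ?_, ?_⟩
  · rw [le_div_iff₀ hy0]
    nlinarith
  · rw [one_div_div, ← sub_div, ← mul_div_assoc, div_lt_one hp0]
    have : 1 - y < p / Q := by rw [hy]; linarith
    rwa [lt_div_iff₀ hQ0, mul_comm] at this
  · rw [div_div_cancel₀ hp0.ne', hy]
    linarith

end XElliptic

/-! ### The `L^∞` bound. -/

open XElliptic in
theorem theorem4p1 {N d : ℕ} (hN : 2 ≤ N) (hd : 2 ≤ d)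
    (X : Fin d → EuclideanSpace ℝ (Fin N) → EuclideanSpace ℝ (Fin N))
    (hX : ∀ j, LocallyLipschitz (X j))
    (hconn : XElliptic.IsXConnected X)
    (hmetric : XElliptic.MetricEquivalent X)
    (Q : ℝ) (hdoubling : XElliptic.IsDoubling X Q)
    (CP ν : ℝ) (hCP : 0 < CP) (hν : 0 < ν) (hpoincare : XElliptic.PoincareIneq X CP ν)
    (Ω : Set (EuclideanSpace ℝ (Fin N))) (hΩ : IsOpen Ω) (hΩb : Bornology.IsBounded Ω)
    (p : ℝ) (hp : 1 < p) (hpQ : p < Q)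
    (m : ℝ≥0∞) (hm : ENNReal.ofReal (Q / p) < m)
    (α : ℝ) (hα : 0 < α) :
    ∃ C : ℝ, 0 < C ∧
      ∀ (β : ℝ) (h : EuclideanSpace ℝ (Fin N) → ℝ)
        (a : EuclideanSpace ℝ (Fin N) → ℝ → EuclideanSpace ℝ (Fin d) → EuclideanSpace ℝ (Fin d))
        (f u : EuclideanSpace ℝ (Fin N) → ℝ),
        0 < β →
        XElliptic.IsLerayLions Ω p α β h a →
        MemLp f m (volume.restrict Ω) →
        XElliptic.IsWeakSolution X Ω p a f u →
        MemLp u ∞ (volume.restrict Ω) ∧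
          eLpNorm u ∞ (volume.restrict Ω) ≤
            ENNReal.ofReal C * eLpNorm f m (volume.restrict Ω) ^ (1 / (p - 1)) := by
  have hp0 : 0 < p := by linarith
  have hp1 : 0 < p - 1 := by linarith
  obtain ⟨q, hpq, hQq, hqm⟩ := exists_exponent hp hpQ hm
  have hq : 1 < q := hp.trans_le hpq
  have hq0 : 0 < q := by linarith
  have hm1 : 1 ≤ m := by
    refine le_trans ?_ hm.le
    rw [ENNReal.one_le_ofReal, le_div_iff₀ hp0]
    linarith
  obtain ⟨S, hS, hsob⟩ := exists_sobolev_const hN hX hconn hmetric hdoubling hν hpoincare hΩ hΩb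
    hp.le hpq hQq
  set s := (p - 1) / q with hs
  set θ := 1 - 1 / q - 1 / m.toReal with hθ
  have hs0 : 0 < s := by positivity
  -- This is `p / q < 1 - 1 / m`; it makes the decay exponent `b = θ / s` exceed `1`.
  have hsθ : s < θ := by rw [hs, hθ, sub_div]; linarith
  have hqm' : 1 / m.toReal ≤ 1 - 1 / q := by linarith
  set b := θ / s with hb
  have hb1 : 1 < b := (one_lt_div hs0).2 hsθ
  set P : ℝ := (volume.restrict Ω Set.univ ^ s).toReal with hP
  have hfin : IsFiniteMeasure (volume.restrict Ω) := ⟨by simpa using hΩb.measure_lt_top⟩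
  set G : ℝ := (S ^ p / ENNReal.ofReal α).toReal with hG
  have hGt : S ^ p / ENNReal.ofReal α ≠ ⊤ := ENNReal.div_ne_top
    (ENNReal.rpow_ne_top_of_nonneg hp0.le hS) (ENNReal.ofReal_pos.2 hα).ne'
  -- With `e = p - 1` and `K = 2 ^ (p - 1) * G * F`, the level condition of `eq_zero_of_decay`
  -- becomes `c * F ≤ M ^ (p - 1)`. The first power of `2` undoes the halving of `l - k`.
  set c : ℝ := 2 ^ (p - 1) * G * 2 ^ (p - 1) * P ^ (b - 1) * 2 ^ ((p - 1) / (b - 1)) with hc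
  have hc0 : 0 ≤ c := by positivity
  refine ⟨(c + 1) ^ (1 / (p - 1)), by positivity, fun β h a f u _ ha hf hu => ?_⟩
  set F : ℝ := (eLpNorm f m (volume.restrict Ω)).toReal with hF
  set ψ : ℝ → ℝ := fun k => (volume.restrict Ω {x | k < |u x|} ^ s).toReal with hψ
  have hψt : ∀ A, volume.restrict Ω A ^ s ≠ ⊤ := fun A =>
    ENNReal.rpow_ne_top_of_nonneg hs0.le (measure_ne_top _ _)
  have hanti : Antitone ψ := fun k l hkl => by
    refine ENNReal.toReal_mono (hψt _) (ENNReal.rpow_le_rpow (measure_mono fun x hx => ?_) hs0.le)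
    exact hkl.trans_lt hx
  have hdecay : ∀ k l, 0 ≤ k → k < l →
      (l - k) ^ (p - 1) * ψ l ≤ (2 ^ (p - 1) * G * F) * ψ k ^ b := by
    intro k l hk hkl
    have h1 := ha.measure_superlevel_decay hp hX hα hq hm1 hqm' hS hsob hf hu hk hkl
    have h2 := ENNReal.toReal_mono (ENNReal.mul_ne_top (ENNReal.mul_ne_top hGt hf.2.ne)
      (ENNReal.rpow_ne_top_of_nonneg (hs0.trans hsθ).le (measure_ne_top _ _))) h1
    rw [ENNReal.toReal_mul, ENNReal.toReal_mul, ENNReal.toReal_mul, ← ENNReal.toReal_rpow,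
      ENNReal.toReal_ofReal (by linarith)] at h2
    have h3 : ψ k ^ b = (volume.restrict Ω {x | k < |u x|} ^ θ).toReal := by
      rw [hψ, ENNReal.toReal_rpow, ← ENNReal.rpow_mul, hb, mul_div_cancel₀ _ hs0.ne']
    have h4 : (l - k) ^ (p - 1) = 2 ^ (p - 1) * ((l - k) / 2) ^ (p - 1) := by
      rw [← Real.mul_rpow (by norm_num) (by linarith)]; congr 1; ring
    rw [h3, h4, mul_assoc, mul_assoc, mul_assoc, ← mul_assoc G]
    exact mul_le_mul_of_nonneg_left h2 (by positivity)
  -- The strict inequality keeps `M` positive even when `c * F = 0`; letting `M` decrease then gives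
  -- the sharp level.
  have hbound : ∀ M : ℝ, (c * F) ^ (1 / (p - 1)) < M →
      eLpNorm u ∞ (volume.restrict Ω) ≤ ENNReal.ofReal M := by
    intro M hM
    have hM0 : 0 < M := lt_of_le_of_lt (by positivity) hM
    have hMp : c * F ≤ M ^ (p - 1) := by
      rw [one_div] at hM
      exact (Real.rpow_inv_le_iff_of_pos (by positivity) hM0.le hp1).1 hM.le
    have hzero := eq_zero_of_decay (fun _ => ENNReal.toReal_nonneg) hanti
      (ENNReal.toReal_mono (hψt _) (ENNReal.rpow_le_rpow (measure_mono (Set.subset_univ _)) hs0.le))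
      hb1 hp1 hM0 (by positivity) hdecay (le_trans (le_of_eq (by rw [hc]; ring)) hMp)
    have hnull : volume.restrict Ω {x | M < |u x|} = 0 := by
      have := (ENNReal.toReal_eq_zero_iff _).1 hzero
      simpa [hψt, hs0, hs0.not_gt] using this
    rw [eLpNorm_exponent_top]
    refine eLpNormEssSup_le_of_ae_bound (C := M) ?_
    rw [ae_iff]
    simpa only [not_le, Real.norm_eq_abs] using hnull
  have hmain : eLpNorm u ∞ (volume.restrict Ω) ≤
      ENNReal.ofReal ((c + 1) ^ (1 / (p - 1))) *
        eLpNorm f m (volume.restrict Ω) ^ (1 / (p - 1)) := by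
    have h1 : eLpNorm u ∞ (volume.restrict Ω) ≤ ENNReal.ofReal ((c * F) ^ (1 / (p - 1))) := by
      have hlim : Tendsto ENNReal.ofReal (𝓝[>] ((c * F) ^ (1 / (p - 1))))
          (𝓝 (ENNReal.ofReal ((c * F) ^ (1 / (p - 1))))) :=
        (ENNReal.continuous_ofReal.tendsto _).mono_left nhdsWithin_le_nhds
      exact ge_of_tendsto hlim (eventually_nhdsWithin_of_forall hbound)
    refine h1.trans ?_
    rw [← ENNReal.ofReal_toReal hf.2.ne, ← hF, ENNReal.ofReal_rpow_of_nonneg (by positivity)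
      (by positivity), ← ENNReal.ofReal_mul (by positivity), ← Real.mul_rpow (by positivity)
      (by positivity)]
    gcongr
    linarith
  refine ⟨⟨hu.choose_spec.1.1.1, hmain.trans_lt ?_⟩, hmain⟩
  exact ENNReal.mul_lt_top ENNReal.ofReal_lt_top
    (ENNReal.rpow_lt_top_of_nonneg (by positivity) hf.2.ne)
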